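/- Let $K$ be a number field with ring of integers $\mathcal O_K$, let $k\ge 2$, and fix a $\mathbb Z$-basis $e_1,\dots,e_d$ of $\mathcal O_K$. For $R\ge 0$ let $B_R\subset\mathcal O_K$ be the finite set of all $a=\sum_i\alpha_ie_i$ ($\alpha_i\in\mathbb Z$) with $\sum_i|\alpha_i|\le R$. Let $\mu$ be the Möbius function on ideals of $\mathcal O_K$, and for $a\in\mathcal O_K$ let $\mu^{(k)}(a)=1$ if $\mathfrak p^k\not\supseteq(a)$ for every nonzero prime ideal $\mathfrak p$, and $\mu^{(k)}(a)=0$ otherwise. Let $X=\{0,1\}^{\mathcal O_K}$ with the $\sigma$-algebra generated by cylinder sets. A probability measure $\Pi$ on $X$ is called natural if for all $r\ge 0$ and $a_0,\dots,a_r\in\mathcal O_K$ the limit below exists and $$\Pi\{x\in X: x(a_0)=\dots=x(a_r)=1\}=c_{r+1}(a_1-a_0,\dots,a_r-a_0),\qquad c_{r+1}(b_1,\dots,b_r)=\lim_{R\to\infty}\frac1{\#B_R}\sum_{c\in B_R}\mu^{(k)}(c)\,\mu^{(k)}(c+b_1)\cdots\mu^{(k)}(c+b_r).$$ There is exactly one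 natural measure $\Pi$. For an ideal $\mathfrak a$ let $\mathfrak a^\perp$ be the set of characters $\chi:(\mathcal O_K,+)\to S^1$ with $\chi(a)=1$ for all $a\in\mathfrak a$. For a square-free ideal $\mathfrak d$ let $(\mathfrak d^k)^\perp_{\mathrm{red}}$ be the set of those $\chi\in(\mathfrak d^k)^\perp$ such that $\mathfrak d\supseteq\mathfrak d'$ for every square-free ideal $\mathfrak d'$ with $\chi\in(\mathfrak d'^k)^\perp$. For $\chi$ in some $(\mathfrak d^k)^\perp_{\mathrm{red}}$ put $$\theta_\chi(x)=\lim_{R\to\infty}\frac1{\#B_R}\sum_{a\in B_R}\chi(-a)\,x(a),\qquad \tilde\theta_\chi=\theta_\chi/\|\theta_\chi\|_{L^2(X,\Pi)};$$ the limit exists for $\Pi$-almost every $x$, and $\theta_\chi\in L^2(X,\Pi)$ is nonzero. Let $\chi_1\in(\mathfrak d_1^k)^\perp_{\mathrm{red}}$ and $\chi_2\in(\mathfrak d_2^k)^\perp_{\mathrm{red}}$, where $\mathfrak d_1,\mathfrak d_2$ are square-free ideals. Then there is exactly one square-free ideal $\mathfrak d$ with $\chi:=\chi_1\chi_2\in(\mathfrak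 d^k)^\perp_{\mathrm{red}}$, and $$\tilde\theta_{\chi_1}\tilde\theta_{\chi_2}=\mu(\mathfrak d_1)\,\mu(\mathfrak d_2)\,\mu(\mathfrak d)\,\tilde\theta_{\chi}\qquad\Pi\text{-almost everywhere}.$$ -/

import Mathlib

open MeasureTheory Filter Topology NumberField

namespace KFreeIntegers

noncomputable section

section Ideals

variable {K : Type*} [Field K]

open scoped Classical in
/-- The indicator `μ^{(k)}` of the `k`-free integers: `1` if no `k`-th power of a (nonzero) prime
ideal divides the principal ideal `(a)`, and `0` otherwise. -/
def kFree (k : ℕ) (a : 𝓞 K) : ℝ :=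
  if ∀ 𝔭 : Ideal (𝓞 K), 𝔭.IsPrime → 𝔭 ≠ ⊥ → ¬ Ideal.span {a} ≤ 𝔭 ^ k then 1 else 0

/-- The annihilator of an ideal: the unitary characters of the additive group of `𝓞 K` that are
trivial on the ideal. -/
def annihilator (𝔞 : Ideal (𝓞 K)) : Set (AddChar (𝓞 K) Circle) :=
  {χ | ∀ a ∈ 𝔞, χ a = 1}

/-- The reduced annihilator `(𝔡 ^ k)^⊥_red` of a square-free ideal `𝔡`: the characters that are
trivial on `𝔡 ^ k`, and trivial on `𝔡' ^ k` for a square-free ideal `𝔡'` only if `𝔡 ⊇ 𝔡'`. -/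
def reducedAnnihilator (k : ℕ) (𝔡 : Ideal (𝓞 K)) : Set (AddChar (𝓞 K) Circle) :=
  {χ | Squarefree 𝔡 ∧ χ ∈ annihilator (𝔡 ^ k) ∧
    ∀ 𝔡' : Ideal (𝓞 K), Squarefree 𝔡' → χ ∈ annihilator (𝔡' ^ k) → 𝔡' ≤ 𝔡}

end Ideals

section Dynamics

variable {K : Type*} [Field K] {ι : Type*} [Fintype ι]

/-- The `L¹` norm on `𝓞 K` in the coordinates given by a `ℤ`-basis. -/
def geomNorm (e : Module.Basis ι ℤ (𝓞 K)) (a : 𝓞 K) : ℝ := ∑ i, |(e.repr a i : ℝ)|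

theorem finite_geomNorm_le (e : Module.Basis ι ℤ (𝓞 K)) (R : ℝ) :
    {a : 𝓞 K | geomNorm e a ≤ R}.Finite := by
  classical
  have hfin : (Set.univ.pi fun _ : ι => Set.Icc (-⌈R⌉) ⌈R⌉).Finite :=
    Set.Finite.pi fun _ => Set.finite_Icc _ _
  refine (hfin.preimage (f := fun a : 𝓞 K => (e.equivFun a : ι → ℤ))
    (e.equivFun.injective.injOn)).subset ?_
  intro a ha i _
  have h1 : |(e.repr a i : ℝ)| ≤ R :=
    (Finset.single_le_sum (f := fun i => |(e.repr a i : ℝ)|) (fun _ _ => abs_nonneg _)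
      (Finset.mem_univ i)).trans ha
  have h2 : |(e.repr a i : ℝ)| ≤ (⌈R⌉ : ℝ) := h1.trans (Int.le_ceil R)
  rw [abs_le] at h2
  simp only [Module.Basis.equivFun_apply, Set.mem_Icc]
  exact ⟨by exact_mod_cast h2.1, by exact_mod_cast h2.2⟩

/-- The ball `B_R` of radius `R` centred at `0` for the `L¹` norm; it is a finite set. -/
def ball (e : Module.Basis ι ℤ (𝓞 K)) (R : ℝ) : Finset (𝓞 K) := (finite_geomNorm_le e R).toFinset

/-- The average over `c ∈ B_R` of `μ^{(k)}(c) μ^{(k)}(c + a₁) ⋯ μ^{(k)}(c + a_r)`, whose limit as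
`R → ∞` is the correlation function `c_{r+1}(a₁, …, a_r)` of the `k`-free integers. -/
def correlationAverage (e : Module.Basis ι ℤ (𝓞 K)) (k : ℕ) {r : ℕ} (a : Fin r → 𝓞 K) (R : ℝ) : ℝ :=
  (∑ c ∈ ball e R, kFree k c * ∏ i, kFree k (c + a i)) / ((ball e R).card : ℝ)

/-- `P` is the natural measure of the `k`-free integers on `X = {0,1}^{𝓞 K}` (with the product
`σ`-algebra): a probability measure such that for all `r ≥ 0` and all `a₀, …, a_r` the correlation
function `c_{r+1}(a₁ - a₀, …, a_r - a₀)` exists and equals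
`P {x | x(a₀) = ⋯ = x(a_r) = 1}`. -/
structure IsNaturalMeasure (e : Module.Basis ι ℤ (𝓞 K)) (k : ℕ)
    (P : Measure (𝓞 K → Bool)) : Prop where
  isProbabilityMeasure : IsProbabilityMeasure P
  tendsto_correlationAverage : ∀ (r : ℕ) (a : Fin (r + 1) → 𝓞 K),
    Tendsto (correlationAverage e k fun i : Fin r => a i.succ - a 0) atTop
      (𝓝 (P.real {x | ∀ i, x (a i) = true}))

/-- The coordinate `x(a) ∈ {0,1}`, as a complex number. -/
def coord (x : 𝓞 K → Bool) (a : 𝓞 K) : ℂ := if x a = true then 1 else 0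

/-- The average over `a ∈ B_R` of `χ(-a) x(a)`. -/
def thetaAverage (e : Module.Basis ι ℤ (𝓞 K)) (χ : AddChar (𝓞 K) Circle) (x : 𝓞 K → Bool)
    (R : ℝ) : ℂ :=
  (∑ a ∈ ball e R, (χ (-a) : ℂ) * coord x a) / ((ball e R).card : ℂ)

/-- The eigenfunction `θ_χ(x) = lim_{R → ∞} (1 / #B_R) ∑_{a ∈ B_R} χ(-a) x(a)`. -/
def theta (e : Module.Basis ι ℤ (𝓞 K)) (χ : AddChar (𝓞 K) Circle) (x : 𝓞 K → Bool) : ℂ :=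
  limUnder atTop (thetaAverage e χ x)

/-- The norm of `θ_χ` in `L²(X, P)`. -/
def thetaNorm (e : Module.Basis ι ℤ (𝓞 K)) (P : Measure (𝓞 K → Bool))
    (χ : AddChar (𝓞 K) Circle) : ℝ :=
  (eLpNorm (theta e χ) 2 P).toReal

/-- The normalized eigenfunction `θ̃_χ = θ_χ / ‖θ_χ‖`. -/
def normalizedTheta (e : Module.Basis ι ℤ (𝓞 K)) (P : Measure (𝓞 K → Bool))
    (χ : AddChar (𝓞 K) Circle) (x : 𝓞 K → Bool) : ℂ :=
  theta e χ x / (thetaNorm e P χ : ℂ)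

end Dynamics

end

end KFreeIntegers

/-! The natural measure has an explicit model. Draw residues h_𝔭 uniformly and independently modulo
𝔭^k for all primes 𝔭, and let x be the indicator of those a with h_𝔭 + a ≠ 0 mod 𝔭^k for every 𝔭.
Sieving by finitely many primes and controlling the tail shows that the correlations of the k-free
integers are the corresponding probabilities for x (`tendsto_ballAvg_prod_kFree`). Events of the
form "x = 1 on a finite set" determine a probability measure, so the law of x is the only natural
measure.

In the model the eigenfunctions can be computed. By the Chinese remainder theorem, sieving x by a
finite set S of primes gives a translate of the integers free of 𝔭^k for 𝔭 in S. Inclusion-exclusion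
for the mean of χ(-b) over those integers keeps only the terms divisible by 𝔡, because χ is reduced
at 𝔡. The mean is therefore a product with factor -N(𝔭)^(-k) at 𝔭 | 𝔡 and 1 - N(𝔭)^(-k) elsewhere.
Letting S grow gives θ_χ(x) = χ(c) μ(𝔡) C with C > 0 a constant and c ≡ h_𝔭 mod 𝔭^k for all 𝔭 | 𝔡
(`exists_tendsto_thetaAverage`). Hence |θ_χ| = C almost everywhere and the normalized eigenfunction
is μ(𝔡) χ(c). The product formula follows from multiplicativity of characters and μ(𝔡)² = 1.

The delicate point is that letting S grow must be justified for almost every h, in all large balls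
simultaneously. The class of -h_𝔭 may contain a point close to 0, which makes it too dense in small
balls. `classWeight` bounds the density of a class over all balls of radius at least 1, up to a
constant. Its average over the classes modulo I is O(N(I)^(-3/4)), which for I = 𝔭^k is summable
over 𝔭 since 3k/4 > 1. Thus the weights of the removed classes are almost surely summable
(`ae_summable_classWeight`), and no ergodic theorem is needed. -/

namespace KFreeIntegers

open IsDedekindDomain

noncomputable section

/-! ### Balls as an averaging sequence, and mean values -/

section Balls

variable {K : Type*} [Field K] {ι : Type*} [Fintype ι] (e : Module.Basis ι ℤ (𝓞 K))

theorem geomNorm_nonneg (a : 𝓞 K) : 0 ≤ geomNorm e a := Finset.sum_nonneg fun _ _ => abs_nonneg _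

theorem geomNorm_zero : geomNorm e 0 = 0 := by simp [geomNorm]

theorem geomNorm_add_le (a b : 𝓞 K) : geomNorm e (a + b) ≤ geomNorm e a + geomNorm e b := by
  simp only [geomNorm, ← Finset.sum_add_distrib, map_add, Finsupp.add_apply, Int.cast_add]
  exact Finset.sum_le_sum fun i _ => abs_add_le _ _

theorem abs_repr_le_geomNorm (a : 𝓞 K) (i : ι) : |(e.repr a i : ℝ)| ≤ geomNorm e a :=
  Finset.single_le_sum (f := fun i => |(e.repr a i : ℝ)|) (fun _ _ => abs_nonneg _)
    (Finset.mem_univ i)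

@[simp]
theorem mem_ball {a : 𝓞 K} {R : ℝ} : a ∈ ball e R ↔ geomNorm e a ≤ R := by simp [ball]

theorem ball_mono {R R' : ℝ} (h : R ≤ R') : ball e R ⊆ ball e R' := fun a ha => by
  rw [mem_ball] at *
  exact ha.trans h

theorem card_ball_pos {R : ℝ} (hR : 0 ≤ R) : 0 < (ball e R).card :=
  Finset.card_pos.mpr ⟨0, by simpa [geomNorm_zero] using hR⟩

/-- The norm takes integer values, so limits over real radii reduce to limits over a countable set
of radii. The measurability of the eigenfunctions rests on this. -/
theorem ball_natFloor {R : ℝ} (hR : 0 ≤ R) : ball e (⌊R⌋₊ : ℝ) = ball e R := by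
  ext a
  have h : geomNorm e a = ((∑ i, (e.repr a i).natAbs : ℕ) : ℝ) := by
    simp [geomNorm, Nat.cast_natAbs]
  rw [mem_ball, mem_ball, h, Nat.cast_le, Nat.le_floor_iff hR]

open scoped Pointwise in
/-- The number of points of a ball grows like a positive multiple of the `d`-th power of the
radius. -/
theorem exists_tendsto_card_ball_div_pow [Nonempty ι] :
    ∃ v : ℝ, 0 < v ∧
      Tendsto (fun R : ℝ => ((ball e R).card : ℝ) / R ^ Fintype.card ι) atTop (𝓝 v) := by
  classical
  set s : Set (ι → ℝ) := {x | ∑ i, |x i| ≤ 1} with hs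
  have hcont : Continuous fun x : ι → ℝ => ∑ i, |x i| := by fun_prop
  have hclosed : IsClosed s := isClosed_le hcont continuous_const
  have hbdd : Bornology.IsBounded s := by
    refine (Metric.isBounded_closedBall (x := (0 : ι → ℝ)) (r := 1)).subset fun x hx => ?_
    rw [mem_closedBall_zero_iff, pi_norm_le_iff_of_nonneg zero_le_one]
    exact fun i => (Finset.single_le_sum (f := fun i => |x i|) (fun _ _ => abs_nonneg _)
      (Finset.mem_univ i)).trans hx
  have hconv : Convex ℝ s := by
    intro x hx y hy a b ha hb hab
    calc ∑ i, |(a • x + b • y) i| ≤ ∑ i, (a * |x i| + b * |y i|) :=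
          Finset.sum_le_sum fun i _ => by
            simpa [abs_mul, abs_of_nonneg ha, abs_of_nonneg hb] using
              abs_add_le (a * x i) (b * y i)
      _ = a * ∑ i, |x i| + b * ∑ i, |y i| := by
          rw [Finset.sum_add_distrib, Finset.mul_sum, Finset.mul_sum]
      _ ≤ a * 1 + b * 1 := by gcongr <;> assumption
      _ = 1 := by linarith
  have hmono : ∀ ⦃x y : ℝ⦄, 0 < x → x ≤ y → x • s ⊆ y • s := by
    rintro x y hx hxy _ ⟨u, hu, rfl⟩
    have hy : 0 < y := hx.trans_le hxy
    refine ⟨(x / y) • u, ?_, ?_⟩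
    · have : ∑ i, |((x / y) • u) i| = (x / y) * ∑ i, |u i| := by
        simp [abs_mul, abs_of_pos hx, abs_of_pos hy, abs_div, Finset.mul_sum]
      change ∑ i, |((x / y) • u) i| ≤ 1
      rw [this]
      exact mul_le_one₀ ((div_le_one hy).mpr hxy) (Finset.sum_nonneg fun _ _ => abs_nonneg _) hu
    · simp only [smul_smul]
      congr 1
      field_simp
  -- Monotonicity of the dilates allows the lattice point count to run over real radii; convexity
  -- makes the boundary a null set.
  have key := tendsto_card_div_pow_atTop_volume' s hbdd hclosed.measurableSet
    (hconv.addHaar_frontier volume) hmono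
  refine ⟨volume.real s, ?_, key.congr' ?_⟩
  · refine ENNReal.toReal_pos ?_ hbdd.measure_lt_top.ne
    refine (IsOpen.measure_pos volume (isOpen_lt hcont (continuous_const (y := (1 : ℝ)))) ⟨0, by
      simp⟩).trans_le (measure_mono fun x hx => ?_) |>.ne'
    exact le_of_lt (show ∑ i, |x i| < 1 from hx)
  · filter_upwards [eventually_gt_atTop (0 : ℝ)] with x hx
    congr 2
    -- Scaled coordinates identify the ball of radius `x` with the points of the lattice `x⁻¹ ℤ^ι`
    -- in the unit body.
    set φ : 𝓞 K → ι → ℝ := fun a i => x⁻¹ * (e.repr a i : ℝ) with hφ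
    have hinj : Function.Injective φ := by
      intro a b hab
      refine e.repr.injective (Finsupp.ext fun i => ?_)
      have := congrFun hab i
      simpa [hφ, hx.ne'] using this
    have himg : s ∩ x⁻¹ • (Submodule.span ℤ (Set.range (Pi.basisFun ℝ ι)) : Set (ι → ℝ)) =
        φ '' (ball e x : Set (𝓞 K)) := by
      ext u
      constructor
      · rintro ⟨hu, w, hw, rfl⟩
        rw [SetLike.mem_coe, Module.Basis.mem_span_iff_repr_mem] at hw
        choose n hn using hw
        simp only [Pi.basisFun_repr, algebraMap_int_eq, eq_intCast] at hn
        have hrep : ∀ i, e.repr (∑ i, n i • e i) i = n i := fun i => by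
          rw [e.repr_sum_self]
        refine ⟨∑ i, n i • e i, ?_, ?_⟩
        · rw [Finset.mem_coe, mem_ball, geomNorm]
          simp only [hrep]
          have h1 : ∑ i, |(x⁻¹ • w) i| = x⁻¹ * ∑ i, |(n i : ℝ)| := by
            simp [abs_mul, abs_of_pos hx, Finset.mul_sum, hn]
          have h2 : ∑ i, |(x⁻¹ • w) i| ≤ 1 := hu
          rw [h1, inv_mul_le_iff₀ hx, mul_one] at h2
          exact h2
        · ext i
          simp only [hφ, hrep, hn, Pi.smul_apply, smul_eq_mul]
      · rintro ⟨a, ha, rfl⟩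
        rw [Finset.mem_coe, mem_ball] at ha
        refine ⟨?_, fun i => (e.repr a i : ℝ), ?_, ?_⟩
        · change ∑ i, |x⁻¹ * (e.repr a i : ℝ)| ≤ 1
          simp_rw [abs_mul, abs_of_pos (inv_pos.mpr hx)]
          rw [← Finset.mul_sum, inv_mul_le_iff₀ hx, mul_one]
          exact ha
        · rw [SetLike.mem_coe, Module.Basis.mem_span_iff_repr_mem]
          exact fun i => ⟨e.repr a i, by simp⟩
        · ext i
          simp [hφ]
    have := Nat.card_image_of_injective hinj (ball e x : Set (𝓞 K))
    rw [himg, this, Nat.card_coe_set_eq, Set.ncard_coe_finset]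

/-- This is the Følner property in disguise: a shell of bounded thickness is negligible, hence
translations do not affect means. -/
theorem tendsto_card_ball_add_div_card_ball [Nonempty ι] (s : ℝ) :
    Tendsto (fun R : ℝ => ((ball e (R + s)).card : ℝ) / (ball e R).card) atTop (𝓝 1) := by
  obtain ⟨v, hv, h⟩ := exists_tendsto_card_ball_div_pow e
  have h1 := h.comp (tendsto_atTop_add_const_right atTop s tendsto_id)
  have h2 : Tendsto (fun R : ℝ => ((R + s) / R) ^ Fintype.card ι) atTop (𝓝 (1 ^ Fintype.card ι)) := by
    refine Tendsto.pow ?_ _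
    have : Tendsto (fun R : ℝ => 1 + s * R⁻¹) atTop (𝓝 (1 + s * 0)) :=
      (tendsto_inv_atTop_zero.const_mul s).const_add 1
    rw [mul_zero, add_zero] at this
    refine this.congr' ?_
    filter_upwards [eventually_gt_atTop (0 : ℝ)] with R hR
    field_simp
  have h3 := (h1.div h hv.ne').mul h2
  rw [div_self hv.ne', one_pow, mul_one] at h3
  refine h3.congr' ?_
  filter_upwards [eventually_gt_atTop (0 : ℝ), eventually_gt_atTop (-s)] with R hR hRs
  have := card_ball_pos e hR.le
  have h4 : 0 < R + s := by linarith
  simp only [Function.comp_apply, id_eq, Pi.div_apply, div_pow]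
  field_simp

/-- The mean of a function over a ball. -/
def ballAvg (f : 𝓞 K → ℂ) (R : ℝ) : ℂ := (∑ a ∈ ball e R, f a) / ((ball e R).card : ℂ)

theorem ballAvg_sum {J : Type*} (s : Finset J) (f : J → 𝓞 K → ℂ) (R : ℝ) :
    ballAvg e (fun a => ∑ j ∈ s, f j a) R = ∑ j ∈ s, ballAvg e (f j) R := by
  simp only [ballAvg]
  rw [Finset.sum_comm, Finset.sum_div]

theorem ballAvg_const_mul (c : ℂ) (f : 𝓞 K → ℂ) (R : ℝ) :
    ballAvg e (fun a => c * f a) R = c * ballAvg e f R := by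
  simp only [ballAvg]
  rw [← Finset.mul_sum, mul_div_assoc]

theorem ballAvg_const (c : ℂ) {R : ℝ} (hR : 0 ≤ R) : ballAvg e (fun _ => c) R = c := by
  have := (card_ball_pos e hR).ne'
  simp only [ballAvg, Finset.sum_const, nsmul_eq_mul]
  field_simp

/-- Means of bounded functions over balls are asymptotically invariant under translations. -/
theorem tendsto_ballAvg_translate_sub [Nonempty ι] {f : 𝓞 K → ℂ} {C : ℝ} (hf : ∀ a, ‖f a‖ ≤ C)
    (t : 𝓞 K) :
    Tendsto (fun R => ballAvg e (fun a => f (a + t)) R - ballAvg e f R) atTop (𝓝 0) := by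
  classical
  set s := geomNorm e t with hs
  have hC : 0 ≤ C := (norm_nonneg _).trans (hf 0)
  have hlim : Tendsto (fun R : ℝ => 2 * C * (((ball e (R + s)).card : ℝ) / (ball e R).card - 1))
      atTop (𝓝 0) := by
    simpa using ((tendsto_card_ball_add_div_card_ball e s).sub_const 1).const_mul (2 * C)
  refine squeeze_zero_norm' ?_ hlim
  filter_upwards [eventually_ge_atTop (0 : ℝ)] with R hR
  have hpos : (0 : ℝ) < (ball e R).card := by exact_mod_cast card_ball_pos e hR
  -- The ball and its translate by `t` have equal size and both lie in the ball of radius `R + s`.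
  -- Each of the two sums is compared with the sum over that larger ball.
  have hbound : ∀ T ⊆ ball e (R + s), T.card = (ball e R).card →
      ‖∑ a ∈ ball e (R + s), f a - ∑ a ∈ T, f a‖ ≤
        C * ((ball e (R + s)).card - (ball e R).card) := by
    intro T hT hcard
    rw [← Finset.sum_sdiff hT, add_sub_cancel_right]
    refine (norm_sum_le _ _).trans ((Finset.sum_le_sum fun a _ => hf a).trans ?_)
    rw [Finset.sum_const, nsmul_eq_mul, mul_comm, Finset.card_sdiff_of_subset hT, hcard,
      Nat.cast_sub (hcard ▸ Finset.card_le_card hT)]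
  have hmap : ∑ a ∈ ball e R, f (a + t) =
      ∑ a ∈ (ball e R).map (addRightEmbedding t), f a := by simp
  have h1 := hbound (ball e R) (ball_mono e (by have := geomNorm_nonneg e t; linarith)) rfl
  have h2 := hbound ((ball e R).map (addRightEmbedding t)) (fun a ha => by
    obtain ⟨b, hb, rfl⟩ := Finset.mem_map.mp ha
    rw [mem_ball] at hb ⊢
    exact (geomNorm_add_le e _ _).trans (by gcongr)) (Finset.card_map _)
  rw [ballAvg, ballAvg, hmap, ← sub_div, norm_div, Complex.norm_natCast, div_le_iff₀ hpos]
  have h3 : 2 * C * (((ball e (R + s)).card : ℝ) / (ball e R).card - 1) * (ball e R).card =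
      2 * C * ((ball e (R + s)).card - (ball e R).card) := by field_simp
  rw [h3]
  have h4 := norm_sub_le
    (∑ a ∈ ball e (R + s), f a - ∑ a ∈ ball e R, f a)
    (∑ a ∈ ball e (R + s), f a - ∑ a ∈ (ball e R).map (addRightEmbedding t), f a)
  rw [sub_sub_sub_cancel_left] at h4
  linarith

/-- A function that factors through a finite quotient has a mean value, the mean over the
quotient. -/
theorem tendsto_ballAvg_comp_addMonoidHom [Nonempty ι] {Q : Type*} [AddCommGroup Q] [Fintype Q]
    (φ : 𝓞 K →+ Q) (hφ : Function.Surjective φ) (g : Q → ℂ) :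
    Tendsto (ballAvg e fun a => g (φ a)) atTop (𝓝 ((∑ q, g q) / (Fintype.card Q : ℂ))) := by
  choose t ht using hφ
  have hb : ∀ a, ‖g (φ a)‖ ≤ ∑ q, ‖g q‖ := fun a =>
    Finset.single_le_sum (f := fun q => ‖g q‖) (fun _ _ => norm_nonneg _) (Finset.mem_univ _)
  -- Averaging over translates by representatives of all classes turns the function into a constant,
  -- and each translation changes the mean by `o(1)`.
  have h1 : Tendsto (fun R => ∑ q, (ballAvg e (fun a => g (φ (a + t q))) R -
      ballAvg e (fun a => g (φ a)) R)) atTop (𝓝 0) := by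
    simpa using tendsto_finsetSum Finset.univ fun q _ =>
      tendsto_ballAvg_translate_sub e hb (t q)
  have hQ : (Fintype.card Q : ℂ) ≠ 0 := Nat.cast_ne_zero.mpr Fintype.card_ne_zero
  have h2 := (h1.const_sub (∑ q, g q)).div_const (Fintype.card Q : ℂ)
  rw [sub_zero] at h2
  refine h2.congr' ?_
  filter_upwards [eventually_ge_atTop (0 : ℝ)] with R hR
  have h3 : ∑ q, ballAvg e (fun a => g (φ (a + t q))) R = ∑ q, g q := by
    rw [← ballAvg_sum]
    have : ∀ a, ∑ q, g (φ (a + t q)) = ∑ q, g q := fun a => by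
      simp only [map_add, ht]
      exact Fintype.sum_equiv (Equiv.addLeft (φ a)) _ _ fun _ => rfl
    simp only [this, ballAvg_const e _ hR]
  rw [Finset.sum_sub_distrib, h3, sub_sub_cancel, Finset.sum_const, nsmul_eq_mul,
    Finset.card_univ, mul_div_cancel_left₀ _ hQ]

/-- A bounded function that is multiplied by a constant `ζ ≠ 1` under some translation has
mean value zero. -/
theorem tendsto_ballAvg_zero_of_twist [Nonempty ι] {f : 𝓞 K → ℂ} {C : ℝ} (hf : ∀ a, ‖f a‖ ≤ C)
    {t : 𝓞 K} {ζ : ℂ} (hζ : ζ ≠ 1) (ht : ∀ a, f (a + t) = ζ * f a) :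
    Tendsto (ballAvg e f) atTop (𝓝 0) := by
  have h := (tendsto_ballAvg_translate_sub e hf t).const_mul (ζ - 1)⁻¹
  rw [mul_zero] at h
  refine h.congr fun R => ?_
  simp only [ht, ballAvg_const_mul]
  have := sub_ne_zero.mpr hζ
  field_simp

/-- Limits can be computed along approximations that are eventually good. -/
theorem tendsto_of_forall_eventually_dist_le {β : Type*} {l : Filter β} [l.NeBot] {f : ℝ → ℂ}
    {g : β → ℝ → ℂ} {m : β → ℂ} {M : ℂ} (hg : ∀ᶠ S in l, Tendsto (g S) atTop (𝓝 (m S)))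
    (hm : Tendsto m l (𝓝 M))
    (h : ∀ ε > 0, ∀ᶠ S in l, ∀ᶠ R in atTop, dist (f R) (g S R) ≤ ε) :
    Tendsto f atTop (𝓝 M) := by
  rw [Metric.tendsto_nhds]
  intro ε hε
  obtain ⟨S, h1, h2, h3⟩ := (hg.and ((Metric.tendsto_nhds.mp hm (ε / 4) (by positivity)).and
    (h (ε / 4) (by positivity)))).exists
  filter_upwards [Metric.tendsto_nhds.mp h1 (ε / 4) (by positivity), h3] with R h4 h5
  have := dist_triangle4 (f R) (g S R) (m S) M
  linarith

end Balls

/-! ### Counting points of ideals and residue classes in balls -/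

section Packing

variable {K : Type*} [Field K] [NumberField K] {ι : Type*} [Fintype ι]
  (e : Module.Basis ι ℤ (𝓞 K))

-- The norm is the determinant of a matrix whose entries are linear in the coordinates of `a`.
omit [NumberField K] in
theorem exists_abs_norm_le :
    ∃ C : ℝ, 0 < C ∧ ∀ a : 𝓞 K,
      |(Algebra.norm ℤ a : ℝ)| ≤ C * geomNorm e a ^ Fintype.card ι := by
  classical
  set M : ℝ := ∑ i, ∑ j, ∑ l, |((Algebra.leftMulMatrix e (e i) j l : ℤ) : ℝ)| with hM
  have hM0 : 0 ≤ M := Finset.sum_nonneg fun _ _ => Finset.sum_nonneg fun _ _ =>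
    Finset.sum_nonneg fun _ _ => abs_nonneg _
  have hentry : ∀ i j l, |((Algebra.leftMulMatrix e (e i) j l : ℤ) : ℝ)| ≤ M := by
    intro i j l
    refine le_trans ?_ (Finset.single_le_sum (f := fun i => ∑ j, ∑ l,
      |((Algebra.leftMulMatrix e (e i) j l : ℤ) : ℝ)|)
      (fun _ _ => Finset.sum_nonneg fun _ _ => Finset.sum_nonneg fun _ _ => abs_nonneg _)
      (Finset.mem_univ i))
    refine le_trans ?_ (Finset.single_le_sum (f := fun j => ∑ l,
      |((Algebra.leftMulMatrix e (e i) j l : ℤ) : ℝ)|)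
      (fun _ _ => Finset.sum_nonneg fun _ _ => abs_nonneg _) (Finset.mem_univ j))
    exact Finset.single_le_sum (f := fun l => |((Algebra.leftMulMatrix e (e i) j l : ℤ) : ℝ)|)
      (fun _ _ => abs_nonneg _) (Finset.mem_univ l)
  refine ⟨(Fintype.card ι).factorial * M ^ Fintype.card ι + 1, by positivity, fun a => ?_⟩
  have hmat : ∀ j l, |((Algebra.leftMulMatrix e a j l : ℤ) : ℝ)| ≤ M * geomNorm e a := by
    intro j l
    have h1 : Algebra.leftMulMatrix e a j l =
        ∑ i, e.repr a i * Algebra.leftMulMatrix e (e i) j l := by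
      conv_lhs => rw [← e.sum_repr a]
      rw [map_sum, Matrix.sum_apply]
      exact Finset.sum_congr rfl fun i _ => by rw [map_zsmul, Matrix.smul_apply, smul_eq_mul]
    rw [h1, Int.cast_sum]
    refine (Finset.abs_sum_le_sum_abs _ _).trans ?_
    rw [geomNorm, Finset.mul_sum]
    refine Finset.sum_le_sum fun i _ => ?_
    rw [Int.cast_mul, abs_mul, mul_comm]
    exact mul_le_mul_of_nonneg_right (hentry i j l) (abs_nonneg _)
  let abv : AbsoluteValue ℤ ℝ :=
    (AbsoluteValue.abs : AbsoluteValue ℝ ℝ).comp (f := Int.castRingHom ℝ) Int.cast_injective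
  have h2 := Matrix.det_le (A := Algebra.leftMulMatrix e a) (abv := abv) (x := M * geomNorm e a)
    (fun j l => hmat j l)
  rw [← Algebra.norm_eq_matrix_det, nsmul_eq_mul, mul_pow, ← mul_assoc] at h2
  have h3 : 0 ≤ geomNorm e a ^ Fintype.card ι := pow_nonneg (geomNorm_nonneg e a) _
  have h4 : |(Algebra.norm ℤ a : ℝ)| ≤
      (Fintype.card ι).factorial * M ^ Fintype.card ι * geomNorm e a ^ Fintype.card ι := h2
  linarith

/-- Since `N(I)` divides the norm of every element of `I`, the nonzero points of `I` are at distance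
at least a multiple of `N(I)^(1/d)` from 0. This separation makes the counts below uniform in `I`.
-/
theorem exists_absNorm_le_of_mem :
    ∃ C : ℝ, 0 < C ∧ ∀ (I : Ideal (𝓞 K)) (a : 𝓞 K), a ∈ I → a ≠ 0 →
      (Ideal.absNorm I : ℝ) ≤ C * geomNorm e a ^ Fintype.card ι := by
  obtain ⟨C, hC, h⟩ := exists_abs_norm_le e
  refine ⟨C, hC, fun I a ha ha0 => le_trans ?_ (h a)⟩
  have h1 := Int.natAbs_dvd_natAbs.mpr (Ideal.absNorm_dvd_norm_of_mem ha)
  have h2 : (Algebra.norm ℤ a).natAbs ≠ 0 := by simpa [Algebra.norm_eq_zero_iff] using ha0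
  have h3 := Nat.le_of_dvd (Nat.pos_of_ne_zero h2) h1
  rw [Int.natAbs_natCast] at h3
  calc (Ideal.absNorm I : ℝ) ≤ ((Algebra.norm ℤ a).natAbs : ℝ) := by exact_mod_cast h3
    _ = |(Algebra.norm ℤ a : ℝ)| := by rw [Nat.cast_natAbs, Int.cast_abs]

theorem absNorm_pos {I : Ideal (𝓞 K)} (hI : I ≠ ⊥) : (0 : ℝ) < Ideal.absNorm I :=
  Nat.cast_pos.mpr (Nat.pos_of_ne_zero (by rwa [Ne, Ideal.absNorm_eq_zero_iff]))

theorem one_le_absNorm {I : Ideal (𝓞 K)} (hI : I ≠ ⊥) : (1 : ℝ) ≤ Ideal.absNorm I :=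
  Nat.one_le_cast.mpr (Nat.pos_of_ne_zero (by rwa [Ne, Ideal.absNorm_eq_zero_iff]))

open scoped Classical in
/-- A bound for the number of points of a ball in a residue class. -/
theorem exists_card_ball_residueClass_le :
    ∃ C : ℝ, 0 < C ∧ ∀ (I : Ideal (𝓞 K)), I ≠ ⊥ → ∀ (q : 𝓞 K ⧸ I) (R : ℝ), 0 ≤ R →
      (((ball e R).filter fun a => Ideal.Quotient.mk I a = q).card : ℝ) ≤
        C * (1 + R ^ Fintype.card ι / Ideal.absNorm I) := by
  have : Nonempty ι := e.index_nonempty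
  set d := Fintype.card ι with hd
  have hd0 : d ≠ 0 := Fintype.card_ne_zero
  have hdpos : (0 : ℝ) < d := Nat.cast_pos.mpr (Nat.pos_of_ne_zero hd0)
  obtain ⟨C₀, hC₀, hnorm⟩ := exists_absNorm_le_of_mem e
  refine ⟨5 ^ d * (1 + d ^ d * C₀), by positivity, fun I hI q R hR => ?_⟩
  set N : ℝ := ((Ideal.absNorm I : ℕ) : ℝ) with hN
  have hNpos : 0 < N := absNorm_pos hI
  -- The side `t` satisfies `C₀ (d t)^d = N`. Two points in one half-open box of side `t` differ by
  -- norm less than `d t`, so distinct points of one class lie in distinct boxes.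
  set t : ℝ := (N / C₀) ^ ((d : ℝ)⁻¹) / d with ht
  have htpos : 0 < t := by positivity
  have hdt : C₀ * (d * t) ^ d = N := by
    rw [ht, mul_div_cancel₀ _ hdpos.ne', Real.rpow_inv_natCast_pow (by positivity) hd0]
    field_simp
  set m : ℕ := ⌈R / t⌉₊ with hm
  have hmle : R / t ≤ m := Nat.le_ceil _
  have hcard : ((ball e R).filter fun a => Ideal.Quotient.mk I a = q).card ≤
      (Fintype.piFinset fun _ : ι => Finset.Icc (-(m : ℤ)) m).card := by
    refine Finset.card_le_card_of_injOn (fun a i => ⌊(e.repr a i : ℝ) / t⌋) ?_ ?_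
    · intro a ha
      rw [Finset.mem_coe, Finset.mem_filter, mem_ball] at ha
      rw [Finset.mem_coe, Fintype.mem_piFinset]
      intro i
      have h1 := abs_le.mp ((abs_repr_le_geomNorm e a i).trans ha.1)
      have h2 : (e.repr a i : ℝ) / t ≤ m := le_trans (by gcongr; exact h1.2) hmle
      have h3 : -(m : ℝ) ≤ (e.repr a i : ℝ) / t := by
        refine (neg_le_neg hmle).trans ?_
        rw [← neg_div]
        gcongr
        exact h1.1
      rw [Finset.mem_Icc]
      refine ⟨Int.le_floor.mpr (by push_cast; exact h3), ?_⟩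
      exact_mod_cast (Int.floor_le _).trans h2
    · intro a ha b hb hab
      rw [Finset.mem_coe, Finset.mem_filter] at ha hb
      by_contra hne
      have hmem : a - b ∈ I := Ideal.Quotient.eq.mp (ha.2.trans hb.2.symm)
      have h1 := hnorm I (a - b) hmem (sub_ne_zero.mpr hne)
      have h2 : geomNorm e (a - b) < d * t := by
        have : ∀ i, |(e.repr (a - b) i : ℝ)| < t := by
          intro i
          have h3 := Int.abs_sub_lt_one_of_floor_eq_floor (congrFun hab i)
          rw [← sub_div, abs_div, abs_of_pos htpos, div_lt_one htpos] at h3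
          simpa using h3
        calc geomNorm e (a - b) < ∑ _i : ι, t :=
              Finset.sum_lt_sum_of_nonempty Finset.univ_nonempty fun i _ => this i
          _ = d * t := by simp [hd]
      have h3 : geomNorm e (a - b) ^ d < (d * t) ^ d :=
        pow_lt_pow_left₀ h2 (geomNorm_nonneg e _) hd0
      have h4 := mul_lt_mul_of_pos_left h3 hC₀
      rw [hdt] at h4
      linarith
  have hbox : (Fintype.piFinset fun _ : ι => Finset.Icc (-(m : ℤ)) m).card = (2 * m + 1) ^ d := by
    rw [Fintype.card_piFinset, Finset.prod_const, Finset.card_univ, Int.card_Icc]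
    congr 1
    omega
  have hm1 : (m : ℝ) < R / t + 1 := Nat.ceil_lt_add_one (by positivity)
  have hfinal : ((2 * m + 1 : ℕ) : ℝ) ^ d ≤ 5 ^ d * (1 + (R / t) ^ d) := by
    have h0 : 0 ≤ R / t := by positivity
    rcases le_total (R / t) 1 with h | h
    · calc ((2 * m + 1 : ℕ) : ℝ) ^ d ≤ 5 ^ d := by
            gcongr
            push_cast
            linarith
        _ ≤ 5 ^ d * (1 + (R / t) ^ d) := le_mul_of_one_le_right (by positivity)
            (le_add_of_nonneg_right (by positivity))
    · calc ((2 * m + 1 : ℕ) : ℝ) ^ d ≤ (5 * (R / t)) ^ d := by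
            gcongr
            push_cast
            linarith
        _ = 5 ^ d * (R / t) ^ d := mul_pow _ _ _
        _ ≤ 5 ^ d * (1 + (R / t) ^ d) := by gcongr; linarith
  have hRt : (R / t) ^ d = d ^ d * C₀ * (R ^ d / N) := by
    have : t ^ d = N / (C₀ * d ^ d) := by
      rw [← hdt, mul_pow]
      field_simp
    rw [div_pow, this]
    field_simp
  calc (((ball e R).filter fun a => Ideal.Quotient.mk I a = q).card : ℝ)
      ≤ ((2 * m + 1 : ℕ) : ℝ) ^ d := by
        rw [hbox] at hcard
        exact_mod_cast hcard
    _ ≤ 5 ^ d * (1 + (R / t) ^ d) := hfinal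
    _ ≤ 5 ^ d * (1 + d ^ d * C₀) * (1 + R ^ d / N) := by
        rw [hRt, mul_assoc (5 ^ d)]
        have h5 : 0 ≤ (d : ℝ) ^ d * C₀ := by positivity
        have h6 : 0 ≤ R ^ d / N := by positivity
        refine mul_le_mul_of_nonneg_left ?_ (by positivity)
        nlinarith

open scoped Classical in
/-- A bound for the number of nonzero points of an ideal in a ball, without an error term. -/
theorem exists_card_ball_ideal_le :
    ∃ C : ℝ, 0 < C ∧ ∀ (I : Ideal (𝓞 K)), I ≠ ⊥ → ∀ R : ℝ, 0 ≤ R →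
      (((ball e R).filter fun a => a ∈ I ∧ a ≠ 0).card : ℝ) ≤
        R ^ Fintype.card ι * (C / Ideal.absNorm I) := by
  obtain ⟨C₀, hC₀, hnorm⟩ := exists_absNorm_le_of_mem e
  obtain ⟨C, hC, hcount⟩ := exists_card_ball_residueClass_le e
  refine ⟨C * (1 + C₀), by positivity, fun I hI R hR => ?_⟩
  have hNpos := absNorm_pos hI
  rcases Finset.eq_empty_or_nonempty ((ball e R).filter fun a => a ∈ I ∧ a ≠ 0) with h | ⟨a, ha⟩
  · rw [h, Finset.card_empty, Nat.cast_zero]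
    positivity
  rw [Finset.mem_filter, mem_ball] at ha
  -- One nonzero point of `I` in the ball already forces the main term to be bounded below, so it
  -- absorbs the error term 1.
  have h1 : (1 : ℝ) ≤ C₀ * (R ^ Fintype.card ι / Ideal.absNorm I) := by
    rw [← mul_div_assoc, one_le_div hNpos]
    refine (hnorm I a ha.2.1 ha.2.2).trans ?_
    have := geomNorm_nonneg e a
    gcongr
    exact ha.1
  calc (((ball e R).filter fun a => a ∈ I ∧ a ≠ 0).card : ℝ)
      ≤ (((ball e R).filter fun a => Ideal.Quotient.mk I a = 0).card : ℝ) := by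
        refine Nat.cast_le.mpr (Finset.card_le_card fun a ha => ?_)
        rw [Finset.mem_filter] at ha ⊢
        exact ⟨ha.1, Ideal.Quotient.eq_zero_iff_mem.mpr ha.2.1⟩
    _ ≤ C * (1 + R ^ Fintype.card ι / Ideal.absNorm I) := hcount I hI 0 R hR
    _ ≤ C * (C₀ * (R ^ Fintype.card ι / Ideal.absNorm I) +
          R ^ Fintype.card ι / Ideal.absNorm I) := by gcongr
    _ = R ^ Fintype.card ι * (C * (1 + C₀) / Ideal.absNorm I) := by ring

theorem exists_card_ball_le :
    ∃ C : ℝ, 0 < C ∧ ∀ R : ℝ, 1 ≤ R → ((ball e R).card : ℝ) ≤ C * R ^ Fintype.card ι := by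
  classical
  obtain ⟨C, hC, hcount⟩ := exists_card_ball_residueClass_le e
  refine ⟨2 * C, by positivity, fun R hR => ?_⟩
  have h := hcount ⊤ top_ne_bot 0 R (by linarith)
  have hall : ∀ a : 𝓞 K, Ideal.Quotient.mk ⊤ a = 0 := fun a =>
    Ideal.Quotient.eq_zero_iff_mem.mpr Submodule.mem_top
  simp only [hall, Finset.filter_true] at h
  have h1 : 1 ≤ R ^ Fintype.card ι := one_le_pow₀ hR
  rw [Ideal.absNorm_top, Nat.cast_one, div_one] at h
  nlinarith

/-- The weight `max(1, |a|)^{-d}`. -/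
def weight (a : 𝓞 K) : ℝ := (max 1 (geomNorm e a) ^ Fintype.card ι)⁻¹

omit [NumberField K] in
theorem weight_nonneg (a : 𝓞 K) : 0 ≤ weight e a :=
  inv_nonneg.mpr (pow_nonneg (le_max_of_le_left zero_le_one) _)

omit [NumberField K] in
theorem weight_le_one (a : 𝓞 K) : weight e a ≤ 1 :=
  inv_le_one_of_one_le₀ (one_le_pow₀ (le_max_left _ _))

/-- Each dyadic shell contributes a bounded amount: about `2^(jd)` points, each of weight at most
`2^(-jd)`. -/
theorem exists_sum_weight_ball_le :
    ∃ C : ℝ, 0 < C ∧ ∀ j : ℕ, ∑ a ∈ ball e (2 ^ j), weight e a ≤ C * (j + 1) := by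
  classical
  obtain ⟨C, hC, hcard⟩ := exists_card_ball_le e
  set d := Fintype.card ι
  refine ⟨C * 2 ^ d, by positivity, fun j => ?_⟩
  induction j with
  | zero =>
    have h1 := hcard 1 le_rfl
    have h2 : ∑ a ∈ ball e (2 ^ 0), weight e a ≤ ∑ a ∈ ball e (2 ^ 0), 1 :=
      Finset.sum_le_sum fun a _ => weight_le_one e a
    have h3 : (1 : ℝ) ≤ 2 ^ d := one_le_pow₀ one_le_two
    simp only [pow_zero, Finset.sum_const, nsmul_eq_mul, mul_one, one_pow] at h1 h2
    simp only [pow_zero, Nat.cast_zero, zero_add, mul_one]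
    nlinarith
  | succ j ih =>
    have hsub : ball e (2 ^ j) ⊆ ball e (2 ^ (j + 1)) :=
      ball_mono e (pow_le_pow_right₀ one_le_two (Nat.le_succ j))
    rw [← Finset.sum_sdiff hsub]
    have h1 : ∑ a ∈ ball e (2 ^ (j + 1)) \ ball e (2 ^ j), weight e a ≤
        ∑ a ∈ ball e (2 ^ (j + 1)) \ ball e (2 ^ j), (((2 : ℝ) ^ j) ^ d)⁻¹ := by
      refine Finset.sum_le_sum fun a ha => ?_
      rw [Finset.mem_sdiff, mem_ball, mem_ball, not_le] at ha
      refine inv_anti₀ (by positivity) ?_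
      gcongr
      exact ha.2.le.trans (le_max_right _ _)
    have h2 : ((ball e (2 ^ (j + 1)) \ ball e (2 ^ j)).card : ℝ) ≤ C * (2 ^ (j + 1)) ^ d :=
      le_trans (by exact_mod_cast Finset.card_le_card Finset.sdiff_subset)
        (hcard _ (one_le_pow₀ one_le_two))
    rw [Finset.sum_const, nsmul_eq_mul] at h1
    have h3 : ((ball e (2 ^ (j + 1)) \ ball e (2 ^ j)).card : ℝ) * (((2 : ℝ) ^ j) ^ d)⁻¹ ≤
        C * 2 ^ d := by
      rw [← div_eq_mul_inv, div_le_iff₀ (by positivity)]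
      refine h2.trans (le_of_eq ?_)
      rw [pow_succ, mul_pow]
      ring
    push_cast
    linarith

/-- A sub-logarithmic bound for the sum of the weights, in the form of a power. -/
theorem exists_sum_weight_ball_le_rpow :
    ∃ C : ℝ, 0 < C ∧ ∀ N : ℕ, 0 < N →
      ∑ a ∈ ball e N, weight e a ≤ C * (N : ℝ) ^ (1 / 4 : ℝ) := by
  obtain ⟨C, hC, h⟩ := exists_sum_weight_ball_le e
  refine ⟨C * (4 / Real.log 2 + 2), by positivity, fun N hN => ?_⟩
  have hN1 : (1 : ℝ) ≤ N := Nat.one_le_cast.mpr hN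
  have hlog2 : 0 < Real.log 2 := Real.log_pos one_lt_two
  set j := Nat.log 2 N with hj
  have h1 : (N : ℝ) ≤ 2 ^ (j + 1) := by
    exact_mod_cast (Nat.lt_pow_succ_log_self one_lt_two N).le
  have h2 : ((2 : ℝ) ^ j) ≤ N := by exact_mod_cast Nat.pow_log_le_self 2 hN.ne'
  have h3 : (j : ℝ) * Real.log 2 ≤ Real.log N := by
    rw [← Real.log_pow]
    exact Real.log_le_log (by positivity) h2
  have h4 := Real.log_le_rpow_div (Nat.cast_nonneg N) (show (0 : ℝ) < 1 / 4 by norm_num)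
  have h5 : (1 : ℝ) ≤ (N : ℝ) ^ (1 / 4 : ℝ) := Real.one_le_rpow hN1 (by norm_num)
  have h6 : (j : ℝ) ≤ 4 / Real.log 2 * (N : ℝ) ^ (1 / 4 : ℝ) := by
    rw [div_mul_eq_mul_div, le_div_iff₀ hlog2]
    linarith
  calc ∑ a ∈ ball e N, weight e a ≤ ∑ a ∈ ball e (2 ^ (j + 1)), weight e a :=
        Finset.sum_le_sum_of_subset_of_nonneg (ball_mono e h1) fun a _ _ => weight_nonneg e a
    _ ≤ C * ((j + 1 : ℕ) + 1) := h (j + 1)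
    _ ≤ C * ((4 / Real.log 2 + 2) * (N : ℝ) ^ (1 / 4 : ℝ)) := by
        gcongr
        push_cast
        linarith
    _ = C * (4 / Real.log 2 + 2) * (N : ℝ) ^ (1 / 4 : ℝ) := by ring

open scoped Classical in
/-- A majorant, up to a constant, for the density of the residue class `q` in all balls of radius
at least `1`. -/
def classWeight {I : Ideal (𝓞 K)} (q : 𝓞 K ⧸ I) : ℝ :=
  (Ideal.absNorm I : ℝ)⁻¹ +
    ∑ a ∈ (ball e (Ideal.absNorm I)).filter fun a => Ideal.Quotient.mk I a = q, weight e a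

theorem classWeight_nonneg {I : Ideal (𝓞 K)} (q : 𝓞 K ⧸ I) : 0 ≤ classWeight e q :=
  add_nonneg (by positivity) (Finset.sum_nonneg fun a _ => weight_nonneg e a)

-- Only the error term 1 of the residue class count needs attention, and only when the ball meets
-- the class. If `R ≥ N(I)`, the summand `N(I)⁻¹` absorbs it. If `R ≤ N(I)`, any point of the class
-- in the ball has weight at least `R^(-d)`.
open scoped Classical in
theorem exists_card_ball_residueClass_le_classWeight :
    ∃ C : ℝ, 0 < C ∧ ∀ (I : Ideal (𝓞 K)), I ≠ ⊥ → ∀ (q : 𝓞 K ⧸ I) (R : ℝ), 1 ≤ R →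
      (((ball e R).filter fun a => Ideal.Quotient.mk I a = q).card : ℝ) ≤
        R ^ Fintype.card ι * (C * classWeight e q) := by
  have : Nonempty ι := e.index_nonempty
  obtain ⟨C, hC, hcount⟩ := exists_card_ball_residueClass_le e
  refine ⟨2 * C, by positivity, fun I hI q R hR => ?_⟩
  set d := Fintype.card ι
  have hd0 : d ≠ 0 := Fintype.card_ne_zero
  have hN := one_le_absNorm hI
  set N : ℝ := ((Ideal.absNorm I : ℕ) : ℝ) with hNdef
  have hw := classWeight_nonneg e q
  have hsum : 0 ≤ ∑ a ∈ (ball e N).filter fun a => Ideal.Quotient.mk I a = q, weight e a :=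
    Finset.sum_nonneg fun a _ => weight_nonneg e a
  rcases Finset.eq_empty_or_nonempty ((ball e R).filter fun a => Ideal.Quotient.mk I a = q)
    with h | ⟨a, ha⟩
  · rw [h, Finset.card_empty, Nat.cast_zero]
    positivity
  rw [Finset.mem_filter, mem_ball] at ha
  have hRd : 0 < R ^ d := by positivity
  have h1 : 1 ≤ R ^ d * classWeight e q := by
    rcases le_total N R with hNR | hNR
    · have : 1 ≤ R ^ d * N⁻¹ := by
        rw [← div_eq_mul_inv, one_le_div (by linarith)]
        exact hNR.trans (le_self_pow₀ hR hd0)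
      refine this.trans ?_
      rw [classWeight]
      gcongr
      linarith
    · have h2 : weight e a ≤
          ∑ a ∈ (ball e N).filter fun a => Ideal.Quotient.mk I a = q, weight e a :=
        Finset.single_le_sum (fun a _ => weight_nonneg e a)
          (Finset.mem_filter.mpr ⟨(mem_ball e).mpr (ha.1.trans hNR), ha.2⟩)
      have h3 : (R ^ d)⁻¹ ≤ weight e a := by
        refine inv_anti₀ (pow_pos (lt_max_of_lt_left one_pos) _) ?_
        have h4 : (0 : ℝ) ≤ max 1 (geomNorm e a) := le_max_of_le_left zero_le_one
        gcongr
        exact max_le hR ha.1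
      have h5 : (R ^ d)⁻¹ ≤ classWeight e q := by
        rw [classWeight]
        have : 0 ≤ N⁻¹ := by positivity
        linarith
      calc (1 : ℝ) = R ^ d * (R ^ d)⁻¹ := by field_simp
        _ ≤ _ := by gcongr
  have h6 : R ^ d / N ≤ R ^ d * classWeight e q := by
    rw [div_eq_mul_inv, classWeight]
    gcongr
    linarith
  calc (((ball e R).filter fun a => Ideal.Quotient.mk I a = q).card : ℝ)
      ≤ C * (1 + R ^ d / N) := hcount I hI q R (by linarith)
    _ ≤ C * (R ^ d * classWeight e q + R ^ d * classWeight e q) := by gcongr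
    _ = _ := by ring

/-- Summed over all classes, the restricted sums recombine into the weight of a whole ball of radius
`N(I)`, which grows only logarithmically. The resulting `log N / N` is weakened to `N^(-3/4)`. -/
theorem exists_sum_classWeight_le :
    ∃ C : ℝ, 0 < C ∧ ∀ (I : Ideal (𝓞 K)), I ≠ ⊥ → ∀ [Fintype (𝓞 K ⧸ I)],
      (∑ q : 𝓞 K ⧸ I, classWeight e q) / Ideal.absNorm I ≤
        C * (Ideal.absNorm I : ℝ) ^ (-(3 / 4) : ℝ) := by
  classical
  obtain ⟨C, hC, h⟩ := exists_sum_weight_ball_le_rpow e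
  refine ⟨1 + C, by positivity, fun I hI _ => ?_⟩
  have hN := one_le_absNorm hI
  have hcard : (Fintype.card (𝓞 K ⧸ I) : ℝ) = Ideal.absNorm I := by
    rw [Ideal.absNorm_apply, Submodule.cardQuot_apply, Nat.card_eq_fintype_card]
  have hsum : ∑ q : 𝓞 K ⧸ I, classWeight e q =
      1 + ∑ a ∈ ball e (Ideal.absNorm I), weight e a := by
    simp only [classWeight, Finset.sum_add_distrib]
    rw [Finset.sum_const, Finset.card_univ, nsmul_eq_mul, hcard, mul_inv_cancel₀ (by positivity)]
    congr 1
    exact Finset.sum_fiberwise _ _ _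
  have h1 := h (Ideal.absNorm I) (by exact_mod_cast hN)
  have h2 : (1 : ℝ) ≤ (Ideal.absNorm I : ℝ) ^ (1 / 4 : ℝ) := Real.one_le_rpow hN (by norm_num)
  have h3 : (Ideal.absNorm I : ℝ) ^ (-(3 / 4) : ℝ) =
      (Ideal.absNorm I : ℝ) ^ (1 / 4 : ℝ) / Ideal.absNorm I := by
    rw [show (-(3 / 4) : ℝ) = 1 / 4 - 1 by norm_num, Real.rpow_sub_one (by positivity)]
  rw [hsum, h3, ← mul_div_assoc]
  gcongr
  linarith

end Packing

/-! ### Convergent series over the prime ideals -/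

section Primes

variable {K : Type*} [Field K] [NumberField K]

instance : Nonempty (HeightOneSpectrum (𝓞 K)) := by
  obtain ⟨M, hM⟩ := Ideal.exists_maximal (𝓞 K)
  exact ⟨⟨M, hM.isPrime, (M.bot_lt_of_maximal (RingOfIntegers.not_isField K)).ne'⟩⟩

omit [NumberField K] in
theorem asIdeal_pow_ne_bot (k : ℕ) (p : HeightOneSpectrum (𝓞 K)) :
    p.asIdeal ^ k ≠ ⊥ := pow_ne_zero k p.ne_bot

instance finite_quotient_pow (k : ℕ) (p : HeightOneSpectrum (𝓞 K)) :
    Finite (𝓞 K ⧸ p.asIdeal ^ k) :=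
  Ideal.finiteQuotientOfFreeOfNeBot _ (asIdeal_pow_ne_bot k p)

theorem one_lt_absNorm_asIdeal (p : HeightOneSpectrum (𝓞 K)) :
    (1 : ℝ) < Ideal.absNorm p.asIdeal := by
  refine lt_of_le_of_ne (one_le_absNorm p.ne_bot) fun h => p.isPrime.ne_top ?_
  rw [← Ideal.absNorm_eq_one_iff]
  exact_mod_cast h.symm

/-- The Dirichlet series of the prime ideals converges to the right of `1`. -/
theorem summable_absNorm_rpow_neg {s : ℝ} (hs : 1 < s) :
    Summable fun p : HeightOneSpectrum (𝓞 K) => (Ideal.absNorm p.asIdeal : ℝ) ^ (-s) := by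
  have hlim := (NumberField.Ideal.tendsto_norm_le_div_atTop K).comp
    ((tendsto_pow_atTop_atTop_of_one_lt (one_lt_two (α := ℝ))).comp (tendsto_add_atTop_nat 1))
  obtain ⟨C, hC⟩ := hlim.bddAbove_range
  have hcount : ∀ j : ℕ, (Nat.card {I : Ideal (𝓞 K) // (Ideal.absNorm I : ℝ) ≤ 2 ^ (j + 1)} : ℝ) ≤
      C * 2 ^ (j + 1) := fun j => by
    have := hC ⟨j, rfl⟩
    simpa [div_le_iff₀] using this
  have hCnn : 0 ≤ C := by
    have := (Nat.cast_nonneg (α := ℝ) _).trans (hcount 0)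
    norm_num at this
    exact this
  have hfin : ∀ j : ℕ, Finite {I : Ideal (𝓞 K) // (Ideal.absNorm I : ℝ) ≤ 2 ^ (j + 1)} := fun j =>
    ((Ideal.finite_setOfPred_absNorm_le (S := 𝓞 K) (2 ^ (j + 1))).subset fun I hI => by
      have : (Ideal.absNorm I : ℝ) ≤ 2 ^ (j + 1) := hI
      exact_mod_cast this).to_subtype
  -- The primes are grouped dyadically by norm. The linear bound for the number of ideals of bounded
  -- norm gives `O(2^j)` primes in block `j`, each contributing at most `2^(-js)`.
  set s' : ℕ → Set (HeightOneSpectrum (𝓞 K)) := fun j =>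
    {p | Nat.log 2 (Ideal.absNorm p.asIdeal) = j} with hs'
  have hmem : ∀ j (p : s' j), (2 : ℝ) ^ j ≤ Ideal.absNorm p.1.asIdeal ∧
      (Ideal.absNorm p.1.asIdeal : ℝ) ≤ 2 ^ (j + 1) := by
    rintro j ⟨p, rfl⟩
    have h0 : Ideal.absNorm p.asIdeal ≠ 0 := by
      have := one_lt_absNorm_asIdeal p
      exact_mod_cast (zero_lt_one.trans this).ne'
    exact ⟨by exact_mod_cast Nat.pow_log_le_self 2 h0,
      by exact_mod_cast (Nat.lt_pow_succ_log_self one_lt_two _).le⟩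
  let φ : ∀ j, s' j → {I : Ideal (𝓞 K) // (Ideal.absNorm I : ℝ) ≤ 2 ^ (j + 1)} := fun j p =>
    ⟨p.1.asIdeal, (hmem j p).2⟩
  have hφ : ∀ j, Function.Injective (φ j) := fun j p q h =>
    Subtype.ext (HeightOneSpectrum.ext (congrArg Subtype.val h))
  have hfin' : ∀ j, Finite (s' j) := fun j => Finite.of_injective (φ j) (hφ j)
  rw [summable_partition (fun p => by positivity) (s := s') fun p => ⟨_, rfl, fun j hj => hj.symm⟩]
  refine ⟨fun j => Summable.of_finite, ?_⟩
  have hgeom : Summable fun j : ℕ => 2 * C * ((2 : ℝ) ^ (1 - s)) ^ j :=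
    (summable_geometric_of_lt_one (by positivity)
      (Real.rpow_lt_one_of_one_lt_of_neg one_lt_two (by linarith))).mul_left _
  refine hgeom.of_nonneg_of_le (fun j => tsum_nonneg fun p => by positivity) fun j => ?_
  have := Fintype.ofFinite (s' j)
  rw [tsum_fintype]
  calc ∑ p : s' j, (Ideal.absNorm p.1.asIdeal : ℝ) ^ (-s) ≤ ∑ _p : s' j, ((2 : ℝ) ^ j) ^ (-s) :=
        Finset.sum_le_sum fun p _ =>
          Real.rpow_le_rpow_of_nonpos (by positivity) (hmem j p).1 (by linarith)
    _ = (Nat.card (s' j) : ℝ) * ((2 : ℝ) ^ j) ^ (-s) := by simp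
    _ ≤ (C * 2 ^ (j + 1)) * ((2 : ℝ) ^ j) ^ (-s) := by
        gcongr
        exact le_trans (by exact_mod_cast Nat.card_le_card_of_injective _ (hφ j)) (hcount j)
    _ = 2 * C * ((2 : ℝ) ^ (1 - s)) ^ j := by
        rw [sub_eq_add_neg, Real.rpow_add two_pos, Real.rpow_one, mul_pow,
          ← Real.rpow_natCast ((2 : ℝ) ^ (-s)), ← Real.rpow_mul two_pos.le,
          ← Real.rpow_natCast 2 j, ← Real.rpow_mul two_pos.le, mul_comm (-s), pow_succ,
          Real.rpow_natCast]
        ring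

theorem summable_absNorm_pow_inv {k : ℕ} (hk : 2 ≤ k) :
    Summable fun p : HeightOneSpectrum (𝓞 K) => (Ideal.absNorm (p.asIdeal ^ k) : ℝ)⁻¹ := by
  refine (summable_absNorm_rpow_neg (K := K) one_lt_two).of_nonneg_of_le
    (fun p => by positivity) fun p => ?_
  have h1 := one_lt_absNorm_asIdeal p
  rw [map_pow, Nat.cast_pow, Real.rpow_neg (by positivity), Real.rpow_two]
  exact inv_anti₀ (by positivity) (pow_le_pow_right₀ h1.le hk)

/-- The exponent `3k/4` is at least `3/2`, so `k ≥ 2` leaves room for the loss from `N⁻¹` to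
`N^(-3/4)`. -/
theorem summable_absNorm_pow_rpow {k : ℕ} (hk : 2 ≤ k) :
    Summable fun p : HeightOneSpectrum (𝓞 K) =>
      (Ideal.absNorm (p.asIdeal ^ k) : ℝ) ^ (-(3 / 4) : ℝ) := by
  refine (summable_absNorm_rpow_neg (K := K) (s := 3 / 2) (by norm_num)).of_nonneg_of_le
    (fun p => by positivity) fun p => ?_
  have h1 := one_lt_absNorm_asIdeal p
  rw [map_pow, Nat.cast_pow, ← Real.rpow_natCast, ← Real.rpow_mul (by positivity)]
  refine Real.rpow_le_rpow_of_exponent_le h1.le ?_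
  have : (2 : ℝ) ≤ k := by exact_mod_cast hk
  linarith

/-- A convergent series of positive terms has a countable index set. Measurability in the random
model depends on it. -/
instance : Countable (HeightOneSpectrum (𝓞 K)) := by
  have h := (summable_absNorm_pow_inv (K := K) le_rfl).countable_support
  rw [Function.support_eq_univ fun p : HeightOneSpectrum (𝓞 K) =>
    inv_ne_zero (absNorm_pos (asIdeal_pow_ne_bot 2 p)).ne'] at h
  exact Set.countable_univ_iff.mp h

omit [NumberField K] in
theorem kFree_eq (k : ℕ) (a : 𝓞 K) [Decidable (∀ p : HeightOneSpectrum (𝓞 K), a ∉ p.asIdeal ^ k)] :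
    kFree k a = if ∀ p : HeightOneSpectrum (𝓞 K), a ∉ p.asIdeal ^ k then 1 else 0 := by
  classical
  rw [kFree]
  refine if_congr ⟨fun h p => ?_, fun h 𝔭 h1 h2 => ?_⟩ rfl rfl
  · have := h p.asIdeal p.isPrime p.ne_bot
    rwa [Ideal.span_singleton_le_iff_mem] at this
  · rw [Ideal.span_singleton_le_iff_mem]
    exact h ⟨𝔭, h1, h2⟩

end Primes

/-! ### Sieving with thin families of sets -/

section Sieve

variable {K : Type*} [Field K] [NumberField K] {ι : Type*} [Fintype ι]
  (e : Module.Basis ι ℤ (𝓞 K)) {β : Type*}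

/-- A family of sets is thin if the densities of its members in all balls of radius at least `1`
are bounded by the terms of a convergent series. -/
def IsThin (A : β → Set (𝓞 K)) : Prop :=
  ∃ w : β → ℝ, Summable w ∧ ∀ p R, 1 ≤ R → ∀ T ⊆ ball e R,
    (∀ a ∈ T, a ∈ A p) → (T.card : ℝ) ≤ R ^ Fintype.card ι * w p

variable {e}

open scoped Classical in
omit [NumberField K] in
theorem IsThin.eventually_card_le {A : β → Set (𝓞 K)} (hA : IsThin e A) {ε : ℝ} (hε : 0 < ε) :
    ∀ᶠ S : Finset β in atTop, ∀ᶠ R in atTop,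
      (((ball e R).filter fun a => ∃ p ∉ S, a ∈ A p).card : ℝ) ≤ ε * (ball e R).card := by
  have : Nonempty ι := e.index_nonempty
  obtain ⟨w, hw, hcount⟩ := hA
  obtain ⟨v, hv, hlim⟩ := exists_tendsto_card_ball_div_pow e
  obtain ⟨S₀, hS₀⟩ := summable_iff_vanishing_norm.mp hw (ε * (v / 2)) (by positivity)
  filter_upwards [eventually_ge_atTop S₀] with S hS
  filter_upwards [hlim.eventually_const_lt (half_lt_self hv), eventually_ge_atTop (1 : ℝ)]
    with R hR hR1
  have hRd : 0 < R ^ Fintype.card ι := by positivity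
  rw [lt_div_iff₀ hRd] at hR
  set E := (ball e R).filter fun a => ∃ p ∉ S, a ∈ A p with hE
  -- Each of the finitely many exceptional points is assigned one index outside `S`, so a finite set
  -- of indices, disjoint from `S₀`, covers them. The value `none` serves the other points, as `β`
  -- may be empty.
  have hex : ∀ a, ∃ p : Option β, a ∈ E → ∃ q ∉ S, p = some q ∧ a ∈ A q := by
    intro a
    by_cases ha : a ∈ E
    · obtain ⟨q, hq, hq'⟩ := (Finset.mem_filter.mp ha).2
      exact ⟨some q, fun _ => ⟨q, hq, rfl, hq'⟩⟩
    · exact ⟨none, fun h => absurd h ha⟩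
  choose P hP using hex
  set Q : Finset β := (E.image P).eraseNone with hQ
  have hdisj : Disjoint Q S₀ := by
    rw [Finset.disjoint_left]
    intro q hq hqS
    rw [hQ, Finset.mem_eraseNone, Finset.mem_image] at hq
    obtain ⟨a, ha, haq⟩ := hq
    obtain ⟨q', hq', h1, -⟩ := hP a ha
    rw [haq, Option.some_inj] at h1
    exact hq' (h1 ▸ hS hqS)
  have hsub : E ⊆ Q.biUnion fun q => (ball e R).filter fun a => a ∈ A q := by
    intro a ha
    obtain ⟨q, hq, h1, h2⟩ := hP a ha
    rw [Finset.mem_biUnion]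
    exact ⟨q, Finset.mem_eraseNone.mpr (Finset.mem_image.mpr ⟨a, ha, h1⟩),
      Finset.mem_filter.mpr ⟨(Finset.mem_filter.mp ha).1, h2⟩⟩
  calc (E.card : ℝ) ≤ ∑ q ∈ Q, (((ball e R).filter fun a => a ∈ A q).card : ℝ) := by
        exact_mod_cast (Finset.card_le_card hsub).trans Finset.card_biUnion_le
    _ ≤ ∑ q ∈ Q, R ^ Fintype.card ι * w q := Finset.sum_le_sum fun q _ =>
        hcount q R hR1 _ (Finset.filter_subset _ _) fun a ha => (Finset.mem_filter.mp ha).2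
    _ = R ^ Fintype.card ι * ∑ q ∈ Q, w q := by rw [Finset.mul_sum]
    _ ≤ R ^ Fintype.card ι * (ε * (v / 2)) := by
        gcongr
        exact (le_abs_self _).trans (hS₀ Q hdisj).le
    _ = ε * (v / 2 * R ^ Fintype.card ι) := by ring
    _ ≤ ε * (ball e R).card := by gcongr

omit [NumberField K] in
theorem dist_ballAvg_le {f g : 𝓞 K → ℂ} {E : 𝓞 K → Prop} [DecidablePred E]
    (h1 : ∀ a, ‖f a - g a‖ ≤ 1) (h2 : ∀ a, f a ≠ g a → E a) (R : ℝ) :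
    dist (ballAvg e f R) (ballAvg e g R) ≤
      (((ball e R).filter E).card : ℝ) / (ball e R).card := by
  rw [dist_eq_norm, ballAvg, ballAvg, ← sub_div, norm_div, Complex.norm_natCast,
    ← Finset.sum_sub_distrib]
  gcongr
  refine (norm_sum_le _ _).trans ?_
  rw [Finset.card_filter, Nat.cast_sum]
  refine Finset.sum_le_sum fun a _ => ?_
  by_cases ha : f a = g a
  · rw [ha, sub_self, norm_zero]
    positivity
  · simpa [h2 a ha] using h1 a

omit [NumberField K] in
/-- If a function agrees with approximations outside of the tails of a thin family, then its mean
value is the limit of the mean values of the approximations. -/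
theorem IsThin.tendsto_ballAvg {A : β → Set (𝓞 K)} (hA : IsThin e A) {f : 𝓞 K → ℂ}
    {g : Finset β → 𝓞 K → ℂ} {m : Finset β → ℂ} {M : ℂ}
    (hbound : ∀ S a, ‖f a - g S a‖ ≤ 1)
    (hdiff : ∀ᶠ S in atTop, ∀ a, f a ≠ g S a → ∃ p ∉ S, a ∈ A p)
    (hg : ∀ᶠ S in atTop, Tendsto (ballAvg e (g S)) atTop (𝓝 (m S)))
    (hm : Tendsto m atTop (𝓝 M)) :
    Tendsto (ballAvg e f) atTop (𝓝 M) := by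
  classical
  refine tendsto_of_forall_eventually_dist_le hg hm fun ε hε => ?_
  filter_upwards [hA.eventually_card_le hε, hdiff] with S h1 h2
  filter_upwards [h1, eventually_ge_atTop (0 : ℝ)] with R h3 hR
  refine (dist_ballAvg_le (hbound S) h2 R).trans ?_
  rwa [div_le_iff₀ (by exact_mod_cast card_ball_pos e hR)]

variable (e) in
/-- The sets of those `c` for which some `c + aᵢ` is nonzero and divisible by the `k`-th power of
a given prime form a thin family. -/
theorem isThin_translates_pow {k : ℕ} (hk : 2 ≤ k) {J : Type*} [Fintype J] (a : J → 𝓞 K) :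
    IsThin e fun (p : HeightOneSpectrum (𝓞 K)) =>
      {c : 𝓞 K | ∃ i, c + a i ∈ p.asIdeal ^ k ∧ c + a i ≠ 0} := by
  classical
  obtain ⟨C, hC, hcount⟩ := exists_card_ball_ideal_le e
  set d := Fintype.card ι
  refine ⟨fun p => (∑ i, (1 + geomNorm e (a i)) ^ d * C) * (Ideal.absNorm (p.asIdeal ^ k) : ℝ)⁻¹,
    (summable_absNorm_pow_inv hk).mul_left _, fun p R hR T hT hTA => ?_⟩
  have hsub : T ⊆ Finset.univ.biUnion fun i => ((ball e (R + geomNorm e (a i))).filter fun c =>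
        c ∈ p.asIdeal ^ k ∧ c ≠ 0).image fun c => c - a i := by
    intro c hc
    have h1 := (mem_ball e).mp (hT hc)
    obtain ⟨i, h2⟩ := hTA c hc
    rw [Finset.mem_biUnion]
    refine ⟨i, Finset.mem_univ i, Finset.mem_image.mpr ⟨c + a i, Finset.mem_filter.mpr
      ⟨?_, h2⟩, add_sub_cancel_right _ _⟩⟩
    rw [mem_ball]
    exact (geomNorm_add_le e _ _).trans (by gcongr)
  have h1 : ∀ i, ((((ball e (R + geomNorm e (a i))).filter fun c =>
      c ∈ p.asIdeal ^ k ∧ c ≠ 0).image fun c => c - a i).card : ℝ) ≤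
      R ^ d * ((1 + geomNorm e (a i)) ^ d * C * (Ideal.absNorm (p.asIdeal ^ k) : ℝ)⁻¹) := by
    intro i
    have h0 := geomNorm_nonneg e (a i)
    have h2 := hcount _ (asIdeal_pow_ne_bot k p) (R + geomNorm e (a i)) (by linarith)
    refine ((Nat.cast_le (α := ℝ)).mpr Finset.card_image_le).trans (h2.trans ?_)
    have h3 : R + geomNorm e (a i) ≤ R * (1 + geomNorm e (a i)) := by nlinarith
    calc (R + geomNorm e (a i)) ^ d * (C / Ideal.absNorm (p.asIdeal ^ k))
        ≤ (R * (1 + geomNorm e (a i))) ^ d * (C / Ideal.absNorm (p.asIdeal ^ k)) := by gcongr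
      _ = _ := by rw [mul_pow]; ring
  refine ((Nat.cast_le (α := ℝ)).mpr ((Finset.card_le_card hsub).trans
    Finset.card_biUnion_le)).trans ?_
  rw [Nat.cast_sum]
  refine (Finset.sum_le_sum fun i _ => h1 i).trans (le_of_eq ?_)
  beta_reduce
  rw [← Finset.mul_sum, Finset.sum_mul]

theorem isThin_residueClasses {k : ℕ} {q : ∀ p : HeightOneSpectrum (𝓞 K), 𝓞 K ⧸ p.asIdeal ^ k}
    (hq : Summable fun p => classWeight e (q p)) :
    IsThin e fun p => {a : 𝓞 K | Ideal.Quotient.mk (p.asIdeal ^ k) a = q p} := by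
  classical
  obtain ⟨C, hC, hcount⟩ := exists_card_ball_residueClass_le_classWeight e
  exact ⟨fun p => C * classWeight e (q p), hq.mul_left C, fun p R hR T hT hTA =>
    (Nat.cast_le.mpr (Finset.card_le_card fun a ha =>
      Finset.mem_filter.mpr ⟨hT ha, hTA a ha⟩)).trans
        (hcount _ (asIdeal_pow_ne_bot k p) (q p) R hR)⟩

end Sieve

/-! ### Square-free ideals and reduced annihilators -/

section SquarefreeIdeals

variable {K : Type*} [Field K] [NumberField K]

theorem prime_asIdeal (p : HeightOneSpectrum (𝓞 K)) : Prime p.asIdeal :=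
  Ideal.prime_of_isPrime p.ne_bot p.isPrime

theorem squarefree_prod_asIdeal (T : Finset (HeightOneSpectrum (𝓞 K))) :
    Squarefree (∏ p ∈ T, p.asIdeal) := by
  refine Finset.squarefree_prod_of_pairwise_isCoprime (fun p _ q _ hpq => ?_)
    fun p _ => (prime_asIdeal p).squarefree
  exact (HeightOneSpectrum.isCoprime_of_ne p q hpq).isRelPrime

theorem prod_asIdeal_le_iff {T : Finset (HeightOneSpectrum (𝓞 K))} {p : HeightOneSpectrum (𝓞 K)} :
    ∏ q ∈ T, q.asIdeal ≤ p.asIdeal ↔ p ∈ T := by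
  constructor
  · intro h
    obtain ⟨q, hq, hqp⟩ := (Ideal.IsPrime.prod_le p.isPrime).mp h
    have : q.asIdeal = p.asIdeal := q.isMaximal.eq_of_le p.isPrime.ne_top hqp
    rwa [← HeightOneSpectrum.ext this]
  · intro h
    exact Ideal.le_of_dvd (Finset.dvd_prod_of_mem _ h)

theorem prod_asIdeal_le_prod_asIdeal_iff {T D : Finset (HeightOneSpectrum (𝓞 K))} :
    ∏ q ∈ T, q.asIdeal ≤ ∏ q ∈ D, q.asIdeal ↔ D ⊆ T := by
  constructor
  · intro h p hp
    exact prod_asIdeal_le_iff.mp (h.trans (prod_asIdeal_le_iff.mpr hp))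
  · intro h
    exact Ideal.le_of_dvd (Finset.prod_dvd_prod_of_subset _ _ _ h)

theorem exists_eq_prod_asIdeal {𝔡 : Ideal (𝓞 K)} (h𝔡 : Squarefree 𝔡) :
    ∃ D : Finset (HeightOneSpectrum (𝓞 K)), 𝔡 = ∏ p ∈ D, p.asIdeal ∧
      UniqueFactorizationMonoid.moebius 𝔡 = (-1) ^ D.card := by
  classical
  have h0 : 𝔡 ≠ 0 := h𝔡.ne_zero
  set m := UniqueFactorizationMonoid.factors 𝔡 with hm
  have hprod : m.prod = 𝔡 := associated_iff_eq.mp (UniqueFactorizationMonoid.factors_prod h0)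
  have hirr : ∀ I ∈ m, Prime I := fun I hI => UniqueFactorizationMonoid.prime_of_factor I hI
  have hnodup : m.Nodup := by
    rw [Multiset.nodup_iff_count_le_one]
    intro I
    by_contra! hI
    have hmem : I ∈ m := Multiset.count_pos.mp (by omega)
    have h1 : Multiset.replicate 2 I ≤ m := Multiset.le_count_iff_replicate_le.mp hI
    have h2 := Multiset.prod_dvd_prod_of_le h1
    rw [hprod, Multiset.prod_replicate, pow_two] at h2
    exact (hirr I hmem).not_isUnit (h𝔡 I h2)
  have hfin : {p : HeightOneSpectrum (𝓞 K) | p.asIdeal ∈ m}.Finite :=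
    (m.toFinset.finite_toSet.preimage (f := HeightOneSpectrum.asIdeal)
      (fun _ _ _ _ h => HeightOneSpectrum.ext h)).subset fun p hp => by simpa using hp
  have hmap : m = hfin.toFinset.val.map HeightOneSpectrum.asIdeal := by
    refine (Multiset.Nodup.ext hnodup (hfin.toFinset.nodup.map
      fun _ _ h => HeightOneSpectrum.ext h)).mpr fun I => ?_
    rw [Multiset.mem_map]
    constructor
    · intro hI
      exact ⟨⟨I, Ideal.isPrime_of_prime (hirr I hI), (hirr I hI).ne_zero⟩, by simpa using hI, rfl⟩
    · rintro ⟨p, hp, rfl⟩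
      simpa using hp
  refine ⟨hfin.toFinset, ?_, ?_⟩
  · exact hprod.symm.trans (congrArg Multiset.prod hmap)
  · rw [h𝔡.moebius_eq, ← hm]
    congr 1
    exact (congrArg Multiset.card hmap).trans (Multiset.card_map _ _)

theorem mem_prod_asIdeal_pow_iff (k : ℕ) (T : Finset (HeightOneSpectrum (𝓞 K))) (b : 𝓞 K) :
    b ∈ (∏ p ∈ T, p.asIdeal) ^ k ↔ ∀ p ∈ T, b ∈ p.asIdeal ^ k := by
  rw [← Finset.prod_pow, ← IsDedekindDomain.inf_pow_eq_prod_of_prime T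
    (fun p => p.asIdeal) (fun _ => k) (fun p _ => prime_asIdeal p)
    (fun p _ q _ hpq h => hpq (HeightOneSpectrum.ext h)), Submodule.mem_finsetInf]

omit [NumberField K] in
theorem annihilator_anti {I J : Ideal (𝓞 K)} (h : I ≤ J) : annihilator J ⊆ annihilator I :=
  fun _ hχ a ha => hχ a (h ha)

omit [NumberField K] in
theorem mem_annihilator_sup {I J : Ideal (𝓞 K)} {χ : AddChar (𝓞 K) Circle}
    (hI : χ ∈ annihilator I) (hJ : χ ∈ annihilator J) : χ ∈ annihilator (I ⊔ J) := by
  intro a ha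
  obtain ⟨x, hx, y, hy, rfl⟩ := Submodule.mem_sup.mp ha
  rw [AddChar.map_add_eq_mul, hI x hx, hJ y hy, one_mul]

/-- After dividing by the greatest common divisor the two ideals are coprime, and so are their
`k`-th powers. -/
theorem sup_pow_le {I J : Ideal (𝓞 K)} (h : I ⊔ J ≠ ⊥) (k : ℕ) : (I ⊔ J) ^ k ≤ I ^ k ⊔ J ^ k := by
  obtain ⟨I', hI⟩ := Ideal.dvd_iff_le.mpr (le_sup_left : I ≤ I ⊔ J)
  obtain ⟨J', hJ⟩ := Ideal.dvd_iff_le.mpr (le_sup_right : J ≤ I ⊔ J)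
  generalize hg : I ⊔ J = g at h hI hJ ⊢
  have h1 : I' ⊔ J' = ⊤ := by
    refine mul_left_cancel₀ (a := g) h ?_
    rw [Ideal.mul_sup, ← hI, ← hJ, Ideal.mul_top, hg]
  rw [hI, hJ, mul_pow, mul_pow, ← Ideal.mul_sup, Ideal.pow_sup_pow_eq_top h1, Ideal.mul_top]

omit [NumberField K] in
theorem eq_of_mem_reducedAnnihilator {k : ℕ} {χ : AddChar (𝓞 K) Circle} {𝔡 𝔡' : Ideal (𝓞 K)}
    (h : χ ∈ reducedAnnihilator k 𝔡) (h' : χ ∈ reducedAnnihilator k 𝔡') : 𝔡 = 𝔡' :=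
  le_antisymm (h'.2.2 𝔡 h.1 h.2.1) (h.2.2 𝔡' h'.1 h'.2.1)

/-- A maximal candidate exists by noetherianity. The sum of two candidates is again one, so the
maximal candidate contains all others. -/
theorem exists_mem_reducedAnnihilator {k : ℕ} {χ : AddChar (𝓞 K) Circle} {𝔡₀ : Ideal (𝓞 K)}
    (h0 : Squarefree 𝔡₀) (hχ : χ ∈ annihilator (𝔡₀ ^ k)) :
    ∃ 𝔡, χ ∈ reducedAnnihilator k 𝔡 := by
  obtain ⟨𝔡, ⟨h1, h2⟩, hmax⟩ := set_has_maximal_iff_noetherian.mpr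
    (inferInstance : IsNoetherian (𝓞 K) (𝓞 K))
    {𝔡 : Ideal (𝓞 K) | Squarefree 𝔡 ∧ χ ∈ annihilator (𝔡 ^ k)} ⟨𝔡₀, h0, hχ⟩
  refine ⟨𝔡, h1, h2, fun 𝔡' h1' h2' => ?_⟩
  have hle : 𝔡 ≤ 𝔡 ⊔ 𝔡' := le_sup_left
  have hne : 𝔡 ⊔ 𝔡' ≠ ⊥ := fun h => h1.ne_zero (by rw [h] at hle; exact le_bot_iff.mp hle)
  have := hmax (𝔡 ⊔ 𝔡') ⟨h1.squarefree_of_dvd (Ideal.dvd_iff_le.mpr hle),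
    annihilator_anti (sup_pow_le hne k) (mem_annihilator_sup h2 h2')⟩
  have heq : 𝔡 = 𝔡 ⊔ 𝔡' := by_contra fun h => this (lt_of_le_of_ne hle h)
  rw [heq]
  exact le_sup_right

theorem existsUnique_mem_reducedAnnihilator_mul {k : ℕ} {χ₁ χ₂ : AddChar (𝓞 K) Circle}
    {𝔡₁ 𝔡₂ : Ideal (𝓞 K)} (h1 : χ₁ ∈ reducedAnnihilator k 𝔡₁)
    (h2 : χ₂ ∈ reducedAnnihilator k 𝔡₂) :
    ∃! 𝔡 : Ideal (𝓞 K), χ₁ * χ₂ ∈ reducedAnnihilator k 𝔡 := by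
  classical
  obtain ⟨D₁, rfl, -⟩ := exists_eq_prod_asIdeal h1.1
  obtain ⟨D₂, rfl, -⟩ := exists_eq_prod_asIdeal h2.1
  obtain ⟨𝔡, h𝔡⟩ := exists_mem_reducedAnnihilator (k := k) (χ := χ₁ * χ₂)
    (squarefree_prod_asIdeal (D₁ ∪ D₂)) fun a ha => by
      rw [mem_prod_asIdeal_pow_iff] at ha
      rw [AddChar.mul_apply, h1.2.1 a, h2.2.1 a, one_mul]
      · exact (mem_prod_asIdeal_pow_iff _ _ _).mpr fun p hp =>
          ha p (Finset.mem_union_right _ hp)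
      · exact (mem_prod_asIdeal_pow_iff _ _ _).mpr fun p hp =>
          ha p (Finset.mem_union_left _ hp)
  exact ⟨𝔡, h𝔡, fun 𝔡' h' => eq_of_mem_reducedAnnihilator h' h𝔡⟩

end SquarefreeIdeals

/-! ### Mean values of characters over sieved integers -/

section TwistedMeans

variable {K : Type*} [Field K] [NumberField K] {ι : Type*} [Fintype ι]
  (e : Module.Basis ι ℤ (𝓞 K))

theorem card_quotient_eq_absNorm (I : Ideal (𝓞 K)) [Fintype (𝓞 K ⧸ I)] :
    Fintype.card (𝓞 K ⧸ I) = Ideal.absNorm I := by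
  rw [Ideal.absNorm_apply, Submodule.cardQuot_apply, Nat.card_eq_fintype_card]

open scoped Classical in
/-- The mean value of a character over an ideal. -/
theorem tendsto_ballAvg_char_mul_indicator {I : Ideal (𝓞 K)} (hI : I ≠ ⊥)
    (χ : AddChar (𝓞 K) Circle) :
    Tendsto (ballAvg e fun b => (χ (-b) : ℂ) * if b ∈ I then 1 else 0) atTop
      (𝓝 (if χ ∈ annihilator I then (Ideal.absNorm I : ℂ)⁻¹ else 0)) := by
  have : Nonempty ι := e.index_nonempty
  split_ifs with h
  · have : Finite (𝓞 K ⧸ I) := Ideal.finiteQuotientOfFreeOfNeBot I hI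
    have := Fintype.ofFinite (𝓞 K ⧸ I)
    have h1 := tendsto_ballAvg_comp_addMonoidHom e (Ideal.Quotient.mk I).toAddMonoidHom
      Ideal.Quotient.mk_surjective fun q => if q = 0 then 1 else 0
    rw [Finset.sum_ite_eq' Finset.univ (0 : 𝓞 K ⧸ I), if_pos (Finset.mem_univ _),
      card_quotient_eq_absNorm, one_div] at h1
    refine h1.congr fun R => ?_
    congr 1
    ext b
    change (if Ideal.Quotient.mk I b = 0 then (1 : ℂ) else 0) = _
    rw [Ideal.Quotient.eq_zero_iff_mem]
    split_ifs with hb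
    · rw [h (-b) (I.neg_mem hb), Circle.coe_one, one_mul]
    · rw [mul_zero]
  · obtain ⟨t, ht, hχt⟩ : ∃ t ∈ I, χ t ≠ 1 := by
      by_contra! h'
      exact h h'
    refine tendsto_ballAvg_zero_of_twist e (C := 1) (t := t) (ζ := (χ (-t) : ℂ)) (fun b => ?_) ?_
      fun b => ?_
    · split_ifs
      · rw [mul_one, Circle.norm_coe]
      · simp
    · rw [Ne, Circle.coe_eq_one, AddChar.map_neg_eq_inv, inv_eq_one]
      exact hχt
    · rw [neg_add, AddChar.map_add_eq_mul, Circle.coe_mul, I.add_mem_iff_left ht]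
      ring

open scoped Classical in
/-- The indicator of the elements that are not divisible by the `k`-th power of a prime in `S`. -/
def truncFree (k : ℕ) (S : Finset (HeightOneSpectrum (𝓞 K))) (b : 𝓞 K) : ℂ :=
  if ∀ p ∈ S, b ∉ p.asIdeal ^ k then 1 else 0

open scoped Classical in
theorem truncFree_eq_sum (k : ℕ) (S : Finset (HeightOneSpectrum (𝓞 K))) (b : 𝓞 K) :
    truncFree k S b = ∑ T ∈ S.powerset,
      (-1) ^ T.card * if b ∈ (∏ p ∈ T, p.asIdeal) ^ k then 1 else 0 := by
  have h1 : truncFree k S b = ∏ p ∈ S, ((1 : ℂ) - if b ∈ p.asIdeal ^ k then 1 else 0) := by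
    rw [truncFree]
    split_ifs with h
    · exact (Finset.prod_eq_one fun p hp => by rw [if_neg (h p hp), sub_zero]).symm
    · push Not at h
      obtain ⟨p, hp, hb⟩ := h
      exact (Finset.prod_eq_zero hp (by rw [if_pos hb, sub_self])).symm
  rw [h1, Finset.prod_sub]
  refine Finset.sum_congr rfl fun T _ => ?_
  rw [Finset.prod_const_one, mul_one, mem_prod_asIdeal_pow_iff]
  congr 1
  split_ifs with h
  · exact Finset.prod_eq_one fun p hp => if_pos (h p hp)
  · push Not at h
    obtain ⟨p, hp, hb⟩ := h
    exact Finset.prod_eq_zero hp (if_neg hb)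

/-- The inverse `N(𝔭 ^ k)⁻¹` of the norm of a prime power. -/
def localDensity (k : ℕ) (p : HeightOneSpectrum (𝓞 K)) : ℝ := (Ideal.absNorm (p.asIdeal ^ k) : ℝ)⁻¹

theorem localDensity_pos (k : ℕ) (p : HeightOneSpectrum (𝓞 K)) : 0 < localDensity k p :=
  inv_pos.mpr (absNorm_pos (asIdeal_pow_ne_bot k p))

theorem localDensity_lt_one {k : ℕ} (hk : k ≠ 0) (p : HeightOneSpectrum (𝓞 K)) :
    localDensity k p < 1 := by
  refine inv_lt_one_of_one_lt₀ ?_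
  rw [map_pow, Nat.cast_pow]
  exact one_lt_pow₀ (one_lt_absNorm_asIdeal p) hk

open scoped Classical in
/-- The mean value of a character over the elements that are not divisible by the `k`-th power of
a prime in `S`. -/
theorem tendsto_ballAvg_char_mul_truncFree {k : ℕ} {χ : AddChar (𝓞 K) Circle}
    {D : Finset (HeightOneSpectrum (𝓞 K))} (hχ : χ ∈ reducedAnnihilator k (∏ p ∈ D, p.asIdeal))
    {S : Finset (HeightOneSpectrum (𝓞 K))} (hS : D ⊆ S) :
    Tendsto (ballAvg e fun b => (χ (-b) : ℂ) * truncFree k S b) atTop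
      (𝓝 (∏ p ∈ S, ((if p ∈ D then 0 else 1) - (localDensity k p : ℂ)))) := by
  -- Reducedness of `χ` leaves exactly the terms `T ⊇ D` of the inclusion-exclusion sum. This is why
  -- the factor at `p ∈ D` has 0 in place of 1.
  have hann : ∀ T : Finset (HeightOneSpectrum (𝓞 K)),
      χ ∈ annihilator ((∏ p ∈ T, p.asIdeal) ^ k) ↔ D ⊆ T := fun T => by
    rw [← prod_asIdeal_le_prod_asIdeal_iff]
    exact ⟨fun h => hχ.2.2 _ (squarefree_prod_asIdeal T) h,
      fun h => annihilator_anti (Ideal.pow_right_mono h k) hχ.2.1⟩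
  have hsum : (fun b => (χ (-b) : ℂ) * truncFree k S b) = fun b => ∑ T ∈ S.powerset,
      (-1) ^ T.card * ((χ (-b) : ℂ) * if b ∈ (∏ p ∈ T, p.asIdeal) ^ k then 1 else 0) := by
    ext b
    rw [truncFree_eq_sum, Finset.mul_sum]
    exact Finset.sum_congr rfl fun T _ => by ring
  rw [hsum, Finset.prod_sub]
  simp_rw [funext (ballAvg_sum e S.powerset _), ballAvg_const_mul]
  refine tendsto_finsetSum _ fun T _ => ?_
  rw [mul_assoc]
  refine Tendsto.const_mul _ ?_
  have hne : (∏ p ∈ T, p.asIdeal) ^ k ≠ ⊥ := pow_ne_zero k (squarefree_prod_asIdeal T).ne_zero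
  convert tendsto_ballAvg_char_mul_indicator e hne χ using 2
  have hnorm : ∏ p ∈ T, (localDensity k p : ℂ) =
      (Ideal.absNorm ((∏ p ∈ T, p.asIdeal) ^ k) : ℂ)⁻¹ := by
    rw [← Finset.prod_pow, map_prod, Nat.cast_prod, ← Finset.prod_inv_distrib]
    simp [localDensity]
  rw [hnorm]
  by_cases h : D ⊆ T
  · rw [if_pos ((hann T).mpr h), Finset.prod_eq_one, one_mul]
    intro p hp
    rw [if_neg]
    exact fun hpD => (Finset.mem_sdiff.mp hp).2 (h hpD)
  · rw [if_neg (mt (hann T).mp h)]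
    obtain ⟨p, hpD, hpT⟩ := Finset.not_subset.mp h
    refine mul_eq_zero_of_left (Finset.prod_eq_zero (Finset.mem_sdiff.mpr ⟨hS hpD, hpT⟩) ?_) _
    exact if_pos hpD

/-- The Euler product of the density of the `k`-free integers converges to a positive limit. -/
theorem exists_tendsto_prod_one_sub_localDensity {k : ℕ} (hk : 2 ≤ k) :
    ∃ P : ℝ, 0 < P ∧ Tendsto (fun S : Finset (HeightOneSpectrum (𝓞 K)) =>
      ∏ p ∈ S, (1 - localDensity k p)) atTop (𝓝 P) := by
  have hsum : Summable fun p : HeightOneSpectrum (𝓞 K) => -localDensity k p :=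
    (summable_absNorm_pow_inv hk).neg
  have hpos : ∀ p : HeightOneSpectrum (𝓞 K), 0 < 1 + -localDensity k p := fun p => by
    have := localDensity_lt_one (by omega : k ≠ 0) p
    linarith
  have hlog := Real.summable_log_one_add_of_summable hsum
  refine ⟨_, Real.exp_pos (∑' p : HeightOneSpectrum (𝓞 K), Real.log (1 + -localDensity k p)),
    ((Real.continuous_exp.tendsto _).comp hlog.hasSum).congr fun S => ?_⟩
  rw [Function.comp_apply, Real.exp_sum]
  exact Finset.prod_congr rfl fun p _ => by rw [Real.exp_log (hpos p), ← sub_eq_add_neg]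

open scoped Classical in
variable (K) in
/-- The limit of the twisted Euler products is `(-1) ^ #D` times a positive number. -/
theorem exists_tendsto_prod_sub_localDensity {k : ℕ} (hk : 2 ≤ k)
    (D : Finset (HeightOneSpectrum (𝓞 K))) :
    ∃ C : ℝ, 0 < C ∧ Tendsto (fun S : Finset (HeightOneSpectrum (𝓞 K)) =>
      ∏ p ∈ S, ((if p ∈ D then 0 else 1) - (localDensity k p : ℂ))) atTop
        (𝓝 ((-1) ^ D.card * (C : ℂ))) := by
  obtain ⟨P, hP, hlim⟩ := exists_tendsto_prod_one_sub_localDensity (K := K) hk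
  have hpos : ∀ p : HeightOneSpectrum (𝓞 K), 0 < 1 - localDensity k p := fun p => by
    have := localDensity_lt_one (by omega : k ≠ 0) p
    linarith
  -- At `p ∈ D` the factor `-δ` is `-δ/(1-δ)` times the untwisted factor `1-δ`, which reduces the
  -- limit to the Euler product of the density.
  set c : ℝ := ∏ p ∈ D, (localDensity k p / (1 - localDensity k p)) with hc
  refine ⟨c * P, mul_pos (Finset.prod_pos fun p _ => div_pos (localDensity_pos k p) (hpos p)) hP,
    ?_⟩
  have h1 := ((Complex.continuous_ofReal.tendsto P).comp hlim).const_mul ((-1) ^ D.card * (c : ℂ))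
  rw [Complex.ofReal_mul, ← mul_assoc]
  refine h1.congr' ?_
  filter_upwards [eventually_ge_atTop D] with S hS
  have hS' : D ⊆ S := hS
  rw [Function.comp_apply, ← Finset.prod_sdiff hS', ← Finset.prod_sdiff hS', hc,
    Complex.ofReal_mul, Complex.ofReal_prod, Complex.ofReal_prod, Complex.ofReal_prod,
    ← Finset.prod_const, mul_left_comm, ← Finset.prod_mul_distrib, ← Finset.prod_mul_distrib]
  congr 1
  · refine Finset.prod_congr rfl fun p hp => ?_
    rw [if_neg (Finset.mem_sdiff.mp hp).2, Complex.ofReal_sub, Complex.ofReal_one]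
  · refine Finset.prod_congr rfl fun p hp => ?_
    have : (1 : ℂ) - localDensity k p ≠ 0 := by exact_mod_cast (hpos p).ne'
    rw [if_pos hp, Complex.ofReal_div, Complex.ofReal_sub, Complex.ofReal_one]
    field_simp
    ring

end TwistedMeans

/-! ### The random model and uniqueness of the natural measure -/

section Model

variable {K : Type*} [Field K] [NumberField K] {ι : Type*} [Fintype ι]

instance (k : ℕ) (p : HeightOneSpectrum (𝓞 K)) : MeasurableSpace (𝓞 K ⧸ p.asIdeal ^ k) := ⊤

instance (k : ℕ) (p : HeightOneSpectrum (𝓞 K)) :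
    DiscreteMeasurableSpace (𝓞 K ⧸ p.asIdeal ^ k) := ⟨fun _ => trivial⟩

instance (k : ℕ) (p : HeightOneSpectrum (𝓞 K)) : IsProbabilityMeasure
    (ProbabilityTheory.uniformOn (Set.univ : Set (𝓞 K ⧸ p.asIdeal ^ k))) :=
  ProbabilityTheory.isProbabilityMeasure_uniformOn Set.finite_univ Set.univ_nonempty

/-- The uniform distribution on the product of the residue rings modulo the `k`-th powers of all
primes. -/
def residueMeasure (K : Type*) [Field K] [NumberField K] (k : ℕ) :
    Measure (∀ p : HeightOneSpectrum (𝓞 K), 𝓞 K ⧸ p.asIdeal ^ k) :=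
  Measure.infinitePi fun _ => ProbabilityTheory.uniformOn Set.univ

instance (k : ℕ) : IsProbabilityMeasure (residueMeasure K k) := by
  unfold residueMeasure
  infer_instance

theorem uniformOn_univ_real (k : ℕ) (p : HeightOneSpectrum (𝓞 K))
    (A : Set (𝓞 K ⧸ p.asIdeal ^ k)) :
    (ProbabilityTheory.uniformOn (Set.univ : Set (𝓞 K ⧸ p.asIdeal ^ k))).real A =
      A.ncard / Ideal.absNorm (p.asIdeal ^ k) := by
  have := Fintype.ofFinite (𝓞 K ⧸ p.asIdeal ^ k)
  rw [Measure.real, ProbabilityTheory.uniformOn_univ, card_quotient_eq_absNorm,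
    Measure.count_apply (MeasurableSet.of_discrete), ENNReal.toReal_div, ENNReal.toReal_natCast,
    ← A.toFinite.cast_ncard_eq, ENat.toENNReal_coe, ENNReal.toReal_natCast]

theorem residueMeasure_real_pi (k : ℕ) (S : Finset (HeightOneSpectrum (𝓞 K)))
    (A : ∀ p : HeightOneSpectrum (𝓞 K), Set (𝓞 K ⧸ p.asIdeal ^ k)) :
    (residueMeasure K k).real {h | ∀ p ∈ S, h p ∈ A p} =
      ∏ p ∈ S, ((A p).ncard : ℝ) / Ideal.absNorm (p.asIdeal ^ k) := by
  have h := Measure.infinitePi_pi (fun p : HeightOneSpectrum (𝓞 K) =>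
    ProbabilityTheory.uniformOn (Set.univ : Set (𝓞 K ⧸ p.asIdeal ^ k))) (s := S) (t := A)
    fun _ _ => MeasurableSet.of_discrete
  change (residueMeasure K k ((S : Set (HeightOneSpectrum (𝓞 K))).pi A)).toReal = _
  rw [residueMeasure, h, ENNReal.toReal_prod]
  exact Finset.prod_congr rfl fun p _ => uniformOn_univ_real k p (A p)

theorem exists_forall_mk_eq {k : ℕ} (S : Finset (HeightOneSpectrum (𝓞 K)))
    (h : ∀ p : S, 𝓞 K ⧸ p.1.asIdeal ^ k) :
    ∃ c : 𝓞 K, ∀ p : S, Ideal.Quotient.mk (p.1.asIdeal ^ k) c = h p :=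
  Ideal.pi_quotient_surjective (I := fun p : S => p.1.asIdeal ^ k) (fun p q hpq =>
    HeightOneSpectrum.isCoprime_pow_of_ne p.1 q.1 (fun h => hpq (Subtype.ext h)) k k) h

open scoped Classical in
/-- The mean value of the indicator of a set that is given by finitely many congruences. -/
theorem tendsto_ballAvg_congruences (e : Module.Basis ι ℤ (𝓞 K)) (k : ℕ)
    (S : Finset (HeightOneSpectrum (𝓞 K)))
    (A : ∀ p : HeightOneSpectrum (𝓞 K), Set (𝓞 K ⧸ p.asIdeal ^ k)) :
    Tendsto (ballAvg e fun c =>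
        if ∀ p ∈ S, Ideal.Quotient.mk (p.asIdeal ^ k) c ∈ A p then 1 else 0) atTop
      (𝓝 (((residueMeasure K k).real {h | ∀ p ∈ S, h p ∈ A p} : ℝ) : ℂ)) := by
  have : Nonempty ι := e.index_nonempty
  have hfin : ∀ p : HeightOneSpectrum (𝓞 K), Fintype (𝓞 K ⧸ p.asIdeal ^ k) := fun p =>
    Fintype.ofFinite _
  let φ : 𝓞 K →+ ∀ p : S, 𝓞 K ⧸ p.1.asIdeal ^ k :=
    (RingHom.pi fun p : S => Ideal.Quotient.mk (p.1.asIdeal ^ k)).toAddMonoidHom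
  have hφ : Function.Surjective φ := fun h => by
    obtain ⟨c, hc⟩ := exists_forall_mk_eq S h
    exact ⟨c, funext hc⟩
  have h1 := tendsto_ballAvg_comp_addMonoidHom e φ hφ fun q =>
    ∏ p : S, if q p ∈ A p.1 then (1 : ℂ) else 0
  convert h1 using 2
  · ext c
    split_ifs with h
    · exact (Finset.prod_eq_one fun p _ => if_pos (h p.1 p.2)).symm
    · push Not at h
      obtain ⟨p, hp, hc⟩ := h
      exact (Finset.prod_eq_zero (Finset.mem_univ (⟨p, hp⟩ : S)) (if_neg hc)).symm
  · rw [residueMeasure_real_pi, ← Fintype.prod_sum (fun (p : S) (q : 𝓞 K ⧸ p.1.asIdeal ^ k) =>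
      if q ∈ A p.1 then (1 : ℂ) else 0), Fintype.card_pi, Nat.cast_prod, ← Finset.prod_div_distrib,
      Complex.ofReal_prod, ← Finset.prod_coe_sort]
    refine Finset.prod_congr rfl fun p _ => ?_
    rw [card_quotient_eq_absNorm, Finset.sum_boole, Set.ncard_eq_toFinset_card']
    push_cast
    congr 3
    ext
    simp

open scoped Classical in
/-- The configuration of the integers that avoid the residue class of `-h` modulo the `k`-th power
of each prime. -/
def configuration {k : ℕ} (h : ∀ p : HeightOneSpectrum (𝓞 K), 𝓞 K ⧸ p.asIdeal ^ k) (a : 𝓞 K) :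
    Bool :=
  decide (∀ p, h p + Ideal.Quotient.mk (p.asIdeal ^ k) a ≠ 0)

omit [NumberField K] in
theorem configuration_eq_true {k : ℕ} {h : ∀ p : HeightOneSpectrum (𝓞 K), 𝓞 K ⧸ p.asIdeal ^ k}
    {a : 𝓞 K} : configuration h a = true ↔
      ∀ p, h p + Ideal.Quotient.mk (p.asIdeal ^ k) a ≠ 0 := by
  simp [configuration]

variable (K) in
theorem measurable_configuration (k : ℕ) : Measurable (configuration (K := K) (k := k)) := by
  refine measurable_pi_lambda _ fun a => measurable_to_bool ?_
  have : (fun h : ∀ p : HeightOneSpectrum (𝓞 K), 𝓞 K ⧸ p.asIdeal ^ k =>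
      configuration h a) ⁻¹' {true} =
      ⋂ p, (fun h => h p) ⁻¹' {q | q + Ideal.Quotient.mk (p.asIdeal ^ k) a ≠ 0} := by
    ext h
    simp [configuration_eq_true]
  rw [this]
  exact MeasurableSet.iInter fun p => measurable_pi_apply p MeasurableSet.of_discrete

/-- The residues mod `p ^ k` for which the integers `a i` are all avoided. -/
def avoidingResidues {k : ℕ} {J : Type*} (a : J → 𝓞 K) (p : HeightOneSpectrum (𝓞 K)) :
    Set (𝓞 K ⧸ p.asIdeal ^ k) :=
  {q | ∀ i, q + Ideal.Quotient.mk (p.asIdeal ^ k) (a i) ≠ 0}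

/-- Continuity from above: the sieved events decrease to the full event as the set of primes grows.
-/
theorem tendsto_residueMeasure_real (k : ℕ) {J : Type*} (a : J → 𝓞 K) :
    Tendsto (fun S : Finset (HeightOneSpectrum (𝓞 K)) =>
      (residueMeasure K k).real {h | ∀ p ∈ S, h p ∈ avoidingResidues a p}) atTop
      (𝓝 ((residueMeasure K k).real {h | ∀ i, configuration h (a i) = true})) := by
  have h1 := tendsto_measure_iInter_atTop (μ := residueMeasure K k)
    (s := fun S : Finset (HeightOneSpectrum (𝓞 K)) =>
      {h | ∀ p ∈ S, h p ∈ avoidingResidues (k := k) a p})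
    (fun S => by
      have : {h : ∀ p : HeightOneSpectrum (𝓞 K), 𝓞 K ⧸ p.asIdeal ^ k |
          ∀ p ∈ S, h p ∈ avoidingResidues a p} =
          ⋂ p ∈ S, (fun h => h p) ⁻¹' avoidingResidues a p := by
        ext h
        simp
      rw [this]
      exact (Finset.measurableSet_biInter S fun p _ =>
        measurable_pi_apply p MeasurableSet.of_discrete).nullMeasurableSet)
    (fun S T hST h hh p hp => hh p (hST hp)) ⟨∅, measure_ne_top _ _⟩
  have h2 : ⋂ S : Finset (HeightOneSpectrum (𝓞 K)),
      {h : ∀ p : HeightOneSpectrum (𝓞 K), 𝓞 K ⧸ p.asIdeal ^ k |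
        ∀ p ∈ S, h p ∈ avoidingResidues a p} = {h | ∀ i, configuration h (a i) = true} := by
    ext h
    simp only [Set.mem_iInter, Set.mem_ofPred_eq, configuration_eq_true, avoidingResidues]
    exact ⟨fun H i p => H {p} p (Finset.mem_singleton_self p) i, fun H S p _ i => H i p⟩
  rw [h2] at h1
  exact (ENNReal.tendsto_toReal (measure_ne_top _ _)).comp h1

open scoped Classical in
/-- The correlations of the `k`-free integers are the probabilities in the random model. -/
theorem tendsto_ballAvg_prod_kFree (e : Module.Basis ι ℤ (𝓞 K)) {k : ℕ} (hk : 2 ≤ k)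
    {J : Type*} [Fintype J] (a : J → 𝓞 K) :
    Tendsto (ballAvg e fun c => ((∏ i, kFree k (c + a i) : ℝ) : ℂ)) atTop
      (𝓝 (((residueMeasure K k).real {h | ∀ i, configuration h (a i) = true} : ℝ) : ℂ)) := by
  have hf : ∀ c, ((∏ i, kFree k (c + a i) : ℝ) : ℂ) =
      if ∀ i (p : HeightOneSpectrum (𝓞 K)), c + a i ∉ p.asIdeal ^ k then 1 else 0 := by
    intro c
    split_ifs with h
    · rw [Finset.prod_eq_one, Complex.ofReal_one]
      exact fun i _ => by rw [kFree_eq, if_pos (h i)]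
    · push Not at h
      obtain ⟨i, p, hp⟩ := h
      rw [Finset.prod_eq_zero (Finset.mem_univ i), Complex.ofReal_zero]
      rw [kFree_eq, if_neg]
      push Not
      exact ⟨p, hp⟩
  have hg : ∀ (S : Finset (HeightOneSpectrum (𝓞 K))) c,
      (∀ p ∈ S, Ideal.Quotient.mk (p.asIdeal ^ k) c ∈ avoidingResidues a p) ↔
        ∀ i, ∀ p ∈ S, c + a i ∉ p.asIdeal ^ k := by
    intro S c
    simp only [avoidingResidues, Set.mem_ofPred_eq, ← map_add, Ne, Ideal.Quotient.eq_zero_iff_mem]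
    exact ⟨fun H i p hp => H p hp i, fun H p hp i => H i p hp⟩
  simp only [hf]
  refine (isThin_translates_pow e hk a).tendsto_ballAvg (g := fun S c =>
    if ∀ p ∈ S, Ideal.Quotient.mk (p.asIdeal ^ k) c ∈ avoidingResidues a p then 1 else 0)
    (fun S c => ?_) ?_ (Eventually.of_forall fun S =>
      tendsto_ballAvg_congruences e k S (avoidingResidues a))
    ((Complex.continuous_ofReal.tendsto _).comp (tendsto_residueMeasure_real k a))
  · split_ifs <;> simp
  · obtain ⟨p₀⟩ := (inferInstance : Nonempty (HeightOneSpectrum (𝓞 K)))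
    filter_upwards [eventually_ge_atTop {p₀}] with S hS c hc
    have hp₀ : p₀ ∈ S := hS (Finset.mem_singleton_self _)
    have h1 : (∀ i, ∀ p ∈ S, c + a i ∉ p.asIdeal ^ k) ∧
        ¬ ∀ i (p : HeightOneSpectrum (𝓞 K)), c + a i ∉ p.asIdeal ^ k := by
      rw [← hg]
      by_contra hcon
      rw [not_and_not_right] at hcon
      refine hc (if_congr ⟨fun H => ?_, hcon⟩ rfl rfl)
      exact (hg S c).mpr fun i p _ => H i p
    obtain ⟨h2, h3⟩ := h1
    push Not at h3
    obtain ⟨i, p, hp⟩ := h3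
    refine ⟨p, fun hpS => h2 i p hpS hp, i, hp, fun h0 => h2 i p₀ hp₀ ?_⟩
    rw [h0]
    exact Submodule.zero_mem _

/-- The law of the random configurations. -/
def naturalMeasure (K : Type*) [Field K] [NumberField K] (k : ℕ) : Measure (𝓞 K → Bool) :=
  (residueMeasure K k).map configuration

theorem naturalMeasure_real {k : ℕ} {s : Set (𝓞 K → Bool)} (hs : MeasurableSet s) :
    (naturalMeasure K k).real s = (residueMeasure K k).real {h | configuration h ∈ s} := by
  rw [naturalMeasure, map_measureReal_apply (measurable_configuration K k) hs]
  rfl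

omit [NumberField K] in
theorem measurableSet_forall_eq_true {J : Type*} [Countable J] (a : J → 𝓞 K) :
    MeasurableSet {x : 𝓞 K → Bool | ∀ i, x (a i) = true} := by
  rw [Set.ofPred_forall]
  exact MeasurableSet.iInter fun i =>
    (measurable_pi_apply (a i) : Measurable fun x : 𝓞 K → Bool => x (a i))
      (measurableSet_singleton true)

theorem isNaturalMeasure_naturalMeasure (e : Module.Basis ι ℤ (𝓞 K)) {k : ℕ} (hk : 2 ≤ k) :
    IsNaturalMeasure e k (naturalMeasure K k) := by
  have : Nonempty ι := e.index_nonempty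
  refine ⟨Measure.isProbabilityMeasure_map (measurable_configuration K k).aemeasurable,
    fun r a => ?_⟩
  rw [naturalMeasure_real (measurableSet_forall_eq_true a)]
  have hb : ∀ c, ‖((∏ i, kFree k (c + a i) : ℝ) : ℂ)‖ ≤ 1 := fun c => by
    rw [Complex.norm_real, Real.norm_eq_abs, Finset.abs_prod]
    refine Finset.prod_le_one (fun _ _ => abs_nonneg _) fun i _ => ?_
    rw [kFree]
    split_ifs <;> simp
  -- Translating by `-a 0` turns the shifts `a i` into the differences `a i - a 0` used in the
  -- correlation functions.
  have h1 := (tendsto_ballAvg_translate_sub e hb (-a 0)).add (tendsto_ballAvg_prod_kFree e hk a)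
  simp only [sub_add_cancel, zero_add] at h1
  have h2 := (Complex.continuous_re.tendsto _).comp h1
  rw [Complex.ofReal_re] at h2
  refine h2.congr fun R => ?_
  have h3 : ballAvg e (fun c => ((∏ i, kFree k (c + -a 0 + a i) : ℝ) : ℂ)) R =
      ((correlationAverage e k (fun i : Fin r => a i.succ - a 0) R : ℝ) : ℂ) := by
    rw [ballAvg, correlationAverage, Complex.ofReal_div, Complex.ofReal_sum, Complex.ofReal_natCast]
    congr 1
    refine Finset.sum_congr rfl fun c _ => ?_
    rw [Fin.prod_univ_succ]
    simp only [neg_add_cancel_right]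
    congr 2
    exact Finset.prod_congr rfl fun i _ => by congr 1; ring
  rw [Function.comp_apply, h3, Complex.ofReal_re]

-- The events "x = 1 on F", for finite F, form a π-system generating the σ-algebra, and for nonempty
-- F their measures are the prescribed limits.
omit [NumberField K] in
theorem isNaturalMeasure_unique {e : Module.Basis ι ℤ (𝓞 K)} {k : ℕ} {P Q : Measure (𝓞 K → Bool)}
    (hP : IsNaturalMeasure e k P) (hQ : IsNaturalMeasure e k Q) : P = Q := by
  classical
  have := hP.isProbabilityMeasure
  have := hQ.isProbabilityMeasure
  refine ext_of_generate_finite {s | ∃ F : Finset (𝓞 K), s = {x | ∀ a ∈ F, x a = true}} ?_ ?_ ?_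
    (by simp)
  · refine le_antisymm ?_ (MeasurableSpace.generateFrom_le ?_)
    · rw [MeasurableSpace.pi, iSup_le_iff]
      intro a
      rw [← measurable_iff_comap_le]
      refine @measurable_to_bool _ (MeasurableSpace.generateFrom _) _ ?_
      exact MeasurableSpace.measurableSet_generateFrom ⟨{a}, by ext x; simp⟩
    · rintro _ ⟨F, rfl⟩
      simpa using measurableSet_forall_eq_true (fun i : F => (i : 𝓞 K))
  · rintro _ ⟨F, rfl⟩ _ ⟨G, rfl⟩ -
    refine ⟨F ∪ G, ?_⟩
    ext x
    simp only [Set.mem_inter_iff, Set.mem_ofPred_eq, Finset.mem_union, or_imp, forall_and]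
  · rintro _ ⟨F, rfl⟩
    rcases F.eq_empty_or_nonempty with rfl | hF
    · simp
    obtain ⟨r, hr⟩ : ∃ r, F.card = r + 1 := ⟨F.card - 1, by have := hF.card_pos; omega⟩
    let a : Fin (r + 1) → 𝓞 K := fun i => (F.equivFinOfCardEq hr).symm i
    have ha : {x : 𝓞 K → Bool | ∀ a ∈ F, x a = true} = {x | ∀ i, x (a i) = true} := by
      ext x
      refine ⟨fun H i => H _ (Subtype.mem _), fun H b hb => ?_⟩
      simpa [a] using H (F.equivFinOfCardEq hr ⟨b, hb⟩)
    have h := tendsto_nhds_unique (hP.tendsto_correlationAverage r a)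
      (hQ.tendsto_correlationAverage r a)
    rw [ha]
    exact (measureReal_eq_measureReal_iff).mp h

end Model

/-! ### Eigenfunctions in the random model -/

section Eigenfunctions

variable {K : Type*} [Field K] [NumberField K] {ι : Type*} [Fintype ι]
  (e : Module.Basis ι ℤ (𝓞 K))

theorem lintegral_classWeight_neg_le : ∃ C : ℝ, 0 < C ∧ ∀ (k : ℕ) (p : HeightOneSpectrum (𝓞 K)),
    ∫⁻ h, ENNReal.ofReal (classWeight e (-h p)) ∂residueMeasure K k ≤
      ENNReal.ofReal (C * (Ideal.absNorm (p.asIdeal ^ k) : ℝ) ^ (-(3 / 4) : ℝ)) := by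
  obtain ⟨C, hC, hsum⟩ := exists_sum_classWeight_le e
  refine ⟨C, hC, fun k p => ?_⟩
  have := Fintype.ofFinite (𝓞 K ⧸ p.asIdeal ^ k)
  have h1 := (measurePreserving_eval_infinitePi (fun p : HeightOneSpectrum (𝓞 K) =>
    ProbabilityTheory.uniformOn (Set.univ : Set (𝓞 K ⧸ p.asIdeal ^ k))) p).lintegral_comp
    (f := fun q => ENNReal.ofReal (classWeight e (-q))) (Measurable.of_discrete)
  rw [residueMeasure]
  refine h1.trans_le ?_
  rw [lintegral_fintype]
  have h2 : ∀ q : 𝓞 K ⧸ p.asIdeal ^ k, ENNReal.ofReal (classWeight e (-q)) *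
      (ProbabilityTheory.uniformOn (Set.univ : Set (𝓞 K ⧸ p.asIdeal ^ k))) {q} =
      ENNReal.ofReal (classWeight e (-q) / Ideal.absNorm (p.asIdeal ^ k)) := fun q => by
    rw [← ofReal_measureReal, uniformOn_univ_real, Set.ncard_singleton,
      ← ENNReal.ofReal_mul (classWeight_nonneg e _), Nat.cast_one, mul_one_div]
  simp only [h2]
  rw [← ENNReal.ofReal_sum_of_nonneg fun q _ =>
    div_nonneg (classWeight_nonneg e _) (Nat.cast_nonneg _), ← Finset.sum_div]
  have h3 : ∑ q : 𝓞 K ⧸ p.asIdeal ^ k, classWeight e (-q) = ∑ q, classWeight e q :=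
    Fintype.sum_equiv (Equiv.neg _) _ _ fun _ => rfl
  rw [h3]
  exact ENNReal.ofReal_le_ofReal (hsum _ (asIdeal_pow_ne_bot k p))

/-- By Tonelli the expectation of the sum is finite. The sign is that of the class removed at `p`,
which is the class of `-h p`. -/
theorem ae_summable_classWeight {k : ℕ} (hk : 2 ≤ k) :
    ∀ᵐ h ∂residueMeasure K k, Summable fun p => classWeight e (-h p) := by
  obtain ⟨C, hC, hle⟩ := lintegral_classWeight_neg_le e
  have hmeas : ∀ p : HeightOneSpectrum (𝓞 K), Measurable
      fun h : ∀ p : HeightOneSpectrum (𝓞 K), 𝓞 K ⧸ p.asIdeal ^ k =>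
        ENNReal.ofReal (classWeight e (-h p)) := fun p =>
    (Measurable.of_discrete (f := fun q : 𝓞 K ⧸ p.asIdeal ^ k =>
      ENNReal.ofReal (classWeight e (-q)))).comp (measurable_pi_apply p)
  have hfin : ∫⁻ h, ∑' p, ENNReal.ofReal (classWeight e (-h p)) ∂residueMeasure K k ≠ ⊤ := by
    rw [lintegral_tsum fun p => (hmeas p).aemeasurable]
    exact ne_top_of_le_ne_top ((summable_absNorm_pow_rpow hk).mul_left C).tsum_ofReal_ne_top
      (ENNReal.tsum_le_tsum fun p => hle k p)
  filter_upwards [ae_lt_top (Measurable.tsum hmeas) hfin] with h hh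
  refine (ENNReal.summable_toReal hh.ne).congr fun p => ?_
  rw [ENNReal.toReal_ofReal (classWeight_nonneg e _)]

omit [NumberField K] in
theorem map_thetaAverage_natCast (χ : AddChar (𝓞 K) Circle) (x : 𝓞 K → Bool) :
    map (fun n : ℕ => thetaAverage e χ x n) atTop = map (thetaAverage e χ x) atTop := by
  refine le_antisymm ?_ ?_
  · exact tendsto_map.comp tendsto_natCast_atTop_atTop
  · have h : thetaAverage e χ x =ᶠ[atTop] fun R => thetaAverage e χ x ((⌊R⌋₊ : ℕ) : ℝ) := by
      filter_upwards [eventually_ge_atTop (0 : ℝ)] with R hR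
      rw [thetaAverage, thetaAverage, ball_natFloor e hR]
    rw [map_congr h]
    exact Tendsto.comp (g := fun n : ℕ => thetaAverage e χ x n) tendsto_map
      (tendsto_nat_floor_atTop (α := ℝ))

omit [NumberField K] in
theorem measurable_thetaAverage (χ : AddChar (𝓞 K) Circle) (R : ℝ) :
    Measurable fun x => thetaAverage e χ x R := by
  refine Measurable.div_const (Finset.measurable_fun_sum _ fun a _ => ?_) _
  refine Measurable.const_mul ?_ _
  exact (Measurable.of_discrete (f := fun b : Bool => if b = true then (1 : ℂ) else 0)).comp
    (measurable_pi_apply a)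

omit [NumberField K] in
theorem measurable_theta (χ : AddChar (𝓞 K) Circle) : Measurable (theta e χ) := by
  have h : theta e χ = fun x => limUnder atTop fun n : ℕ => thetaAverage e χ x n := by
    ext x
    rw [theta, limUnder, limUnder, map_thetaAverage_natCast]
  rw [h]
  exact (StronglyMeasurable.limUnder fun n : ℕ =>
    (measurable_thetaAverage e χ n).stronglyMeasurable).measurable

omit [NumberField K] in
theorem measurableSet_tendsto_thetaAverage (χ : AddChar (𝓞 K) Circle) :
    MeasurableSet {x | Tendsto (thetaAverage e χ x) atTop (𝓝 (theta e χ x))} := by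
  have h := measurableSet_tendsto_fun (l := atTop)
    (fun n : ℕ => measurable_thetaAverage e χ n) (measurable_theta e χ)
  simpa only [Tendsto, map_thetaAverage_natCast] using h

theorem exists_forall_le_mk_eq {k : ℕ} {𝔡 : Ideal (𝓞 K)} (h𝔡 : 𝔡 ≠ ⊥)
    (h : ∀ p : HeightOneSpectrum (𝓞 K), 𝓞 K ⧸ p.asIdeal ^ k) :
    ∃ c : 𝓞 K, ∀ p : HeightOneSpectrum (𝓞 K), 𝔡 ≤ p.asIdeal →
      Ideal.Quotient.mk (p.asIdeal ^ k) c = h p := by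
  have hfin : {p : HeightOneSpectrum (𝓞 K) | p.asIdeal ∣ 𝔡}.Finite :=
    Ideal.finite_factors h𝔡
  obtain ⟨c, hc⟩ := exists_forall_mk_eq hfin.toFinset fun p => h p.1
  exact ⟨c, fun p hp => hc ⟨p, by simpa using Ideal.dvd_iff_le.mpr hp⟩⟩

/-- The eigenfunctions in the random model are, up to constants, characters. -/
theorem exists_tendsto_thetaAverage {k : ℕ} (hk : 2 ≤ k) {𝔡 : Ideal (𝓞 K)}
    {χ : AddChar (𝓞 K) Circle} (hχ : χ ∈ reducedAnnihilator k 𝔡) :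
    ∃ C : ℝ, 0 < C ∧ ∀ h : ∀ p : HeightOneSpectrum (𝓞 K), 𝓞 K ⧸ p.asIdeal ^ k,
      Summable (fun p => classWeight e (-h p)) → ∀ c : 𝓞 K,
      (∀ p : HeightOneSpectrum (𝓞 K), 𝔡 ≤ p.asIdeal → Ideal.Quotient.mk (p.asIdeal ^ k) c = h p) →
      Tendsto (thetaAverage e χ (configuration h)) atTop
        (𝓝 ((χ c : ℂ) * ((UniqueFactorizationMonoid.moebius 𝔡 : ℂ) * C))) := by
  classical
  have : Nonempty ι := e.index_nonempty
  obtain ⟨D, rfl, hmoebius⟩ := exists_eq_prod_asIdeal hχ.1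
  obtain ⟨C, hC, hlim⟩ := exists_tendsto_prod_sub_localDensity K hk D
  refine ⟨C, hC, fun h hh c hc => ?_⟩
  -- Modulo the primes in `S`, the residues `h` come from one integer `cS S`, so the configuration
  -- sieved by `S` is a translate of the truncated `k`-free integers.
  choose cS hcS using fun S : Finset (HeightOneSpectrum (𝓞 K)) =>
    exists_forall_mk_eq S fun p => h p.1
  have hmem : ∀ (S : Finset (HeightOneSpectrum (𝓞 K))) (a : 𝓞 K), ∀ p ∈ S,
      (a + cS S ∈ p.asIdeal ^ k ↔ h p + Ideal.Quotient.mk (p.asIdeal ^ k) a = 0) := by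
    intro S a p hp
    rw [← Ideal.Quotient.eq_zero_iff_mem, map_add, hcS S ⟨p, hp⟩, add_comm]
  have hcoord : ∀ a, coord (configuration h) a =
      if ∀ p, h p + Ideal.Quotient.mk (p.asIdeal ^ k) a ≠ 0 then 1 else 0 := fun a => by
    rw [coord]
    exact if_congr configuration_eq_true rfl rfl
  have htrunc : ∀ S a, truncFree k S (a + cS S) =
      if ∀ p ∈ S, h p + Ideal.Quotient.mk (p.asIdeal ^ k) a ≠ 0 then 1 else 0 := fun S a => by
    rw [truncFree]
    exact if_congr (forall₂_congr fun p hp => not_congr (hmem S a p hp)) rfl rfl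
  -- The phase produced by the translation stabilizes: `cS S - c` lies in `𝔡 ^ k`, where `χ` is
  -- trivial.
  have hχc : ∀ S, D ⊆ S → χ (cS S) = χ c := by
    intro S hS
    have h1 : χ (cS S - c) = 1 := by
      refine hχ.2.1 _ ((mem_prod_asIdeal_pow_iff k D _).mpr fun p hp => ?_)
      rw [← Ideal.Quotient.eq_zero_iff_mem, map_sub, hcS S ⟨p, hS hp⟩,
        hc p (prod_asIdeal_le_iff.mpr hp), sub_self]
    rwa [AddChar.map_sub_eq_div, div_eq_one] at h1
  have hmoeb : (UniqueFactorizationMonoid.moebius (∏ p ∈ D, p.asIdeal) : ℂ) = (-1) ^ D.card := by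
    rw [hmoebius]
    push_cast
    rfl
  rw [hmoeb]
  refine (isThin_residueClasses hh).tendsto_ballAvg
    (f := fun a => (χ (-a) : ℂ) * coord (configuration h) a)
    (g := fun S a => (χ (-a) : ℂ) * truncFree k S (a + cS S)) (fun S a => ?_)
    (Eventually.of_forall fun S a hne => ?_) ?_ (hlim.const_mul (χ c : ℂ))
  · rw [hcoord, htrunc, ← mul_sub, norm_mul, Circle.norm_coe, one_mul]
    split_ifs <;> simp
  · rw [hcoord, htrunc] at hne
    by_contra hcon
    push Not at hcon
    refine hne ?_
    congr 1
    refine if_congr ⟨fun H p _ => H p, fun H p => ?_⟩ rfl rfl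
    by_cases hp : p ∈ S
    · exact H p hp
    · intro h0
      exact hcon p hp (eq_neg_of_add_eq_zero_right h0)
  · filter_upwards [eventually_ge_atTop D] with S hS
    set G : 𝓞 K → ℂ := fun b => (χ (-b) : ℂ) * truncFree k S b with hG
    have hb : ∀ b, ‖G b‖ ≤ 1 := fun b => by
      rw [hG]
      simp only [norm_mul, Circle.norm_coe, one_mul, truncFree]
      split_ifs <;> simp
    have h1 := ((tendsto_ballAvg_translate_sub e hb (cS S)).add
      (tendsto_ballAvg_char_mul_truncFree e hχ hS)).const_mul (χ c : ℂ)
    simp only [zero_add, hG, sub_add_cancel, ← ballAvg_const_mul] at h1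
    refine h1.congr fun R => ?_
    congr 1
    ext a
    rw [← mul_assoc, ← Circle.coe_mul, ← hχc S hS, ← AddChar.map_add_eq_mul]
    congr 3
    ring_nf

end Eigenfunctions

/-! ### Transfer to the natural measure and the product formula -/

section NaturalMeasure

variable {K : Type*} [Field K] [NumberField K] {ι : Type*} [Fintype ι]
  {e : Module.Basis ι ℤ (𝓞 K)}

theorem moebius_mul_self {𝔡 : Ideal (𝓞 K)} (h𝔡 : Squarefree 𝔡) :
    UniqueFactorizationMonoid.moebius 𝔡 * UniqueFactorizationMonoid.moebius 𝔡 = 1 := by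
  rw [h𝔡.moebius_eq, ← pow_add, Even.neg_one_pow ⟨_, rfl⟩]

theorem ae_naturalMeasure_iff {k : ℕ} {s : Set (𝓞 K → Bool)} (hs : MeasurableSet s) :
    (∀ᵐ x ∂naturalMeasure K k, x ∈ s) ↔ ∀ᵐ h ∂residueMeasure K k, configuration h ∈ s :=
  ae_map_iff (measurable_configuration K k).aemeasurable hs

instance (k : ℕ) : IsProbabilityMeasure (naturalMeasure K k) :=
  Measure.isProbabilityMeasure_map (measurable_configuration K k).aemeasurable

theorem ae_tendsto_thetaAverage {k : ℕ} (hk : 2 ≤ k) {𝔡 : Ideal (𝓞 K)} {χ : AddChar (𝓞 K) Circle}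
    (hχ : χ ∈ reducedAnnihilator k 𝔡) :
    ∀ᵐ x ∂naturalMeasure K k, Tendsto (thetaAverage e χ x) atTop (𝓝 (theta e χ x)) := by
  refine (ae_naturalMeasure_iff (measurableSet_tendsto_thetaAverage e χ)).mpr ?_
  obtain ⟨C, -, hlim⟩ := exists_tendsto_thetaAverage e hk hχ
  filter_upwards [ae_summable_classWeight e hk] with h hh
  obtain ⟨c, hc⟩ := exists_forall_le_mk_eq hχ.1.ne_zero h
  exact tendsto_nhds_limUnder ⟨_, hlim h hh c hc⟩

/-- The character value and the Möbius sign both have modulus 1, so the modulus is constant and the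
constant is also the `L²` norm. -/
theorem ae_norm_theta_eq {k : ℕ} {χ : AddChar (𝓞 K) Circle}
    {𝔡 : Ideal (𝓞 K)} (hk : 2 ≤ k) (hχ : χ ∈ reducedAnnihilator k 𝔡) {C : ℝ} (hC : 0 < C)
    (hlim : ∀ h : ∀ p : HeightOneSpectrum (𝓞 K), 𝓞 K ⧸ p.asIdeal ^ k,
      Summable (fun p => classWeight e (-h p)) → ∀ c : 𝓞 K,
      (∀ p : HeightOneSpectrum (𝓞 K), 𝔡 ≤ p.asIdeal → Ideal.Quotient.mk (p.asIdeal ^ k) c = h p) →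
      Tendsto (thetaAverage e χ (configuration h)) atTop
        (𝓝 ((χ c : ℂ) * ((UniqueFactorizationMonoid.moebius 𝔡 : ℂ) * C)))) :
    ∀ᵐ x ∂naturalMeasure K k, ‖theta e χ x‖ = C := by
  refine (ae_naturalMeasure_iff (s := {x | ‖theta e χ x‖ = C})
    (measurableSet_eq_fun (measurable_theta e χ).norm measurable_const)).mpr ?_
  filter_upwards [ae_summable_classWeight e hk] with h hh
  obtain ⟨c, hc⟩ := exists_forall_le_mk_eq hχ.1.ne_zero h
  have hm : ‖(UniqueFactorizationMonoid.moebius 𝔡 : ℂ)‖ = 1 := by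
    rw [hχ.1.moebius_eq]
    simp
  rw [theta, (hlim h hh c hc).limUnder_eq, norm_mul, norm_mul, Circle.norm_coe, hm,
    Complex.norm_real, Real.norm_of_nonneg hC.le, one_mul, one_mul]

theorem thetaNorm_eq {k : ℕ} {χ : AddChar (𝓞 K) Circle} {C : ℝ} (hC : 0 < C)
    (hnorm : ∀ᵐ x ∂naturalMeasure K k, ‖theta e χ x‖ = C) :
    thetaNorm e (naturalMeasure K k) χ = C := by
  have h : eLpNorm (theta e χ) 2 (naturalMeasure K k) =
      eLpNorm (fun _ => C) 2 (naturalMeasure K k) := by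
    refine eLpNorm_congr_norm_ae ?_
    filter_upwards [hnorm] with x hx
    rw [hx, Real.norm_of_nonneg hC.le]
  rw [thetaNorm, h, eLpNorm_const _ two_ne_zero (IsProbabilityMeasure.ne_zero _), measure_univ,
    ENNReal.one_rpow, mul_one, Real.enorm_of_nonneg hC.le, ENNReal.toReal_ofReal hC.le]

theorem memLp_theta_and_thetaNorm_pos {k : ℕ} (hk : 2 ≤ k) {𝔡 : Ideal (𝓞 K)}
    {χ : AddChar (𝓞 K) Circle} (hχ : χ ∈ reducedAnnihilator k 𝔡) :
    MemLp (theta e χ) 2 (naturalMeasure K k) ∧ 0 < thetaNorm e (naturalMeasure K k) χ := by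
  obtain ⟨C, hC, hlim⟩ := exists_tendsto_thetaAverage e hk hχ
  have hnorm := ae_norm_theta_eq hk hχ hC hlim
  refine ⟨MemLp.of_bound (measurable_theta e χ).aestronglyMeasurable C ?_, ?_⟩
  · filter_upwards [hnorm] with x hx using hx.le
  · rwa [thetaNorm_eq hC hnorm]

/-- The normalized eigenfunctions in the random model are characters up to the sign `μ(𝔡)`. -/
theorem normalizedTheta_configuration {k : ℕ} (hk : 2 ≤ k) {𝔡 : Ideal (𝓞 K)}
    {χ : AddChar (𝓞 K) Circle} (hχ : χ ∈ reducedAnnihilator k 𝔡)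
    {h : ∀ p : HeightOneSpectrum (𝓞 K), 𝓞 K ⧸ p.asIdeal ^ k}
    (hh : Summable fun p => classWeight e (-h p)) {c : 𝓞 K}
    (hc : ∀ p : HeightOneSpectrum (𝓞 K), 𝔡 ≤ p.asIdeal →
      Ideal.Quotient.mk (p.asIdeal ^ k) c = h p) :
    normalizedTheta e (naturalMeasure K k) χ (configuration h) =
      (χ c : ℂ) * (UniqueFactorizationMonoid.moebius 𝔡 : ℂ) := by
  obtain ⟨C, hC, hlim⟩ := exists_tendsto_thetaAverage e hk hχ
  have hC' : (C : ℂ) ≠ 0 := by exact_mod_cast hC.ne'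
  rw [normalizedTheta, thetaNorm_eq hC (ae_norm_theta_eq hk hχ hC hlim), theta,
    (hlim h hh c hc).limUnder_eq]
  field_simp

theorem normalizedTheta_mul {k : ℕ} (hk : 2 ≤ k) {𝔡₁ 𝔡₂ 𝔡 : Ideal (𝓞 K)}
    {χ₁ χ₂ : AddChar (𝓞 K) Circle} (h₁ : χ₁ ∈ reducedAnnihilator k 𝔡₁)
    (h₂ : χ₂ ∈ reducedAnnihilator k 𝔡₂) (h₁₂ : χ₁ * χ₂ ∈ reducedAnnihilator k 𝔡) :
    (fun x => normalizedTheta e (naturalMeasure K k) χ₁ x *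
      normalizedTheta e (naturalMeasure K k) χ₂ x) =ᵐ[naturalMeasure K k]
    fun x => ((UniqueFactorizationMonoid.moebius 𝔡₁ * UniqueFactorizationMonoid.moebius 𝔡₂ *
      UniqueFactorizationMonoid.moebius 𝔡 : ℤ) : ℂ) *
        normalizedTheta e (naturalMeasure K k) (χ₁ * χ₂) x := by
  have hmeas : ∀ χ, Measurable (normalizedTheta e (naturalMeasure K k) χ) := fun χ =>
    (measurable_theta e χ).div_const _
  have hs := measurableSet_eq_fun ((hmeas χ₁).mul (hmeas χ₂))
    ((hmeas (χ₁ * χ₂)).const_mul ((UniqueFactorizationMonoid.moebius 𝔡₁ *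
      UniqueFactorizationMonoid.moebius 𝔡₂ * UniqueFactorizationMonoid.moebius 𝔡 : ℤ) : ℂ))
  refine (ae_naturalMeasure_iff hs).mpr ?_
  filter_upwards [ae_summable_classWeight e hk] with h hh
  -- Solving the congruences at all primes dividing this product gives one `c` at which all three
  -- characters can be evaluated.
  have hne : 𝔡₁ * 𝔡₂ * 𝔡 ≠ ⊥ :=
    mul_ne_zero (mul_ne_zero h₁.1.ne_zero h₂.1.ne_zero) h₁₂.1.ne_zero
  obtain ⟨c, hc⟩ := exists_forall_le_mk_eq hne h
  have l₁ : 𝔡₁ * 𝔡₂ * 𝔡 ≤ 𝔡₁ :=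
    Ideal.le_of_dvd ((dvd_mul_right 𝔡₁ 𝔡₂).trans (dvd_mul_right _ 𝔡))
  have l₂ : 𝔡₁ * 𝔡₂ * 𝔡 ≤ 𝔡₂ :=
    Ideal.le_of_dvd ((dvd_mul_left 𝔡₂ 𝔡₁).trans (dvd_mul_right _ 𝔡))
  have l₁₂ : 𝔡₁ * 𝔡₂ * 𝔡 ≤ 𝔡 := Ideal.le_of_dvd (dvd_mul_left 𝔡 _)
  have e₁ := normalizedTheta_configuration (e := e) hk h₁ hh fun p hp =>
    hc p (l₁.trans hp)
  have e₂ := normalizedTheta_configuration (e := e) hk h₂ hh fun p hp =>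
    hc p (l₂.trans hp)
  have e₁₂ := normalizedTheta_configuration (e := e) hk h₁₂ hh fun p hp =>
    hc p (l₁₂.trans hp)
  change normalizedTheta e (naturalMeasure K k) χ₁ (configuration h) *
    normalizedTheta e (naturalMeasure K k) χ₂ (configuration h) =
    ((UniqueFactorizationMonoid.moebius 𝔡₁ * UniqueFactorizationMonoid.moebius 𝔡₂ *
      UniqueFactorizationMonoid.moebius 𝔡 : ℤ) : ℂ) *
        normalizedTheta e (naturalMeasure K k) (χ₁ * χ₂) (configuration h)
  have hsq : (UniqueFactorizationMonoid.moebius 𝔡 : ℂ) *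
      (UniqueFactorizationMonoid.moebius 𝔡 : ℂ) = 1 := by
    exact_mod_cast moebius_mul_self h₁₂.1
  rw [e₁, e₂, e₁₂, AddChar.mul_apply, Circle.coe_mul]
  push_cast
  linear_combination (-(χ₁ c : ℂ) * χ₂ c * UniqueFactorizationMonoid.moebius 𝔡₁ *
    UniqueFactorizationMonoid.moebius 𝔡₂) * hsq

end NaturalMeasure

end

end KFreeIntegers

theorem mainTheorem9 {K : Type*} [Field K] [NumberField K] {ι : Type*} [Fintype ι]
    (e : Module.Basis ι ℤ (𝓞 K)) (k : ℕ) (hk : 2 ≤ k) :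
    (∃! P : Measure (𝓞 K → Bool), KFreeIntegers.IsNaturalMeasure e k P) ∧
    ∀ P : Measure (𝓞 K → Bool), KFreeIntegers.IsNaturalMeasure e k P →
      (∀ (𝔡 : Ideal (𝓞 K)) (χ : AddChar (𝓞 K) Circle),
        χ ∈ KFreeIntegers.reducedAnnihilator k 𝔡 →
          (∀ᵐ x ∂P, Tendsto (KFreeIntegers.thetaAverage e χ x) atTop
            (𝓝 (KFreeIntegers.theta e χ x))) ∧
          MemLp (KFreeIntegers.theta e χ) 2 P ∧
          0 < KFreeIntegers.thetaNorm e P χ) ∧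
      ∀ (𝔡₁ 𝔡₂ : Ideal (𝓞 K)) (χ₁ χ₂ : AddChar (𝓞 K) Circle),
        χ₁ ∈ KFreeIntegers.reducedAnnihilator k 𝔡₁ →
        χ₂ ∈ KFreeIntegers.reducedAnnihilator k 𝔡₂ →
          (∃! 𝔡 : Ideal (𝓞 K), χ₁ * χ₂ ∈ KFreeIntegers.reducedAnnihilator k 𝔡) ∧
          ∀ 𝔡 : Ideal (𝓞 K), χ₁ * χ₂ ∈ KFreeIntegers.reducedAnnihilator k 𝔡 →
            (fun x => KFreeIntegers.normalizedTheta e P χ₁ x *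
              KFreeIntegers.normalizedTheta e P χ₂ x) =ᵐ[P]
            fun x => ((UniqueFactorizationMonoid.moebius 𝔡₁ * UniqueFactorizationMonoid.moebius 𝔡₂ *
              UniqueFactorizationMonoid.moebius 𝔡 : ℤ) : ℂ) *
                KFreeIntegers.normalizedTheta e P (χ₁ * χ₂) x := by
  have hnat := KFreeIntegers.isNaturalMeasure_naturalMeasure e hk
  refine ⟨⟨_, hnat, fun P hP => KFreeIntegers.isNaturalMeasure_unique hP hnat⟩, fun P hP => ?_⟩
  -- By uniqueness, an arbitrary natural measure is the law of the random model, where everything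
  -- has been computed.
  obtain rfl := KFreeIntegers.isNaturalMeasure_unique hP hnat
  exact ⟨fun 𝔡 χ hχ => ⟨KFreeIntegers.ae_tendsto_thetaAverage hk hχ,
      KFreeIntegers.memLp_theta_and_thetaNorm_pos hk hχ⟩,
    fun 𝔡₁ 𝔡₂ χ₁ χ₂ h₁ h₂ => ⟨KFreeIntegers.existsUnique_mem_reducedAnnihilator_mul h₁ h₂,
      fun 𝔡 h₁₂ => KFreeIntegers.normalizedTheta_mul hk h₁ h₂ h₁₂⟩⟩
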